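/- For $\nu\in\mathbb{R}$ let $K_\nu$ denote the modified Bessel function of the second kind (principal branch): the unique holomorphic solution on $\mathbb{C}\setminus(-\infty,0]$ of $z^2w''+zw'-(z^2+\nu^2)w=0$ with $w(r)\sim\sqrt{\pi/(2r)}\,e^{-r}$ as $r\to+\infty$. For $z\in\mathbb{C}\setminus[1,\infty)$ let ${}_2F_1(a,b;c;z)$ denote the principal branch of the Gauss hypergeometric function, that is, the analytic continuation along the segment $[0,z]$ of the power series $\sum_{n\ge 0}\frac{(a)_n(b)_n}{(c)_n}\frac{z^n}{n!}$. Let $x\in\mathbb{C}$, $x\neq 0$, $|\arg x|<\pi$, let $t>0$ and $\nu\in\mathbb{R}$. Then the integral below converges absolutely and $$e^{2t\,\mathrm{Re}\,x}\,|K_\nu(tx)|^2=\pi\,(2|x|)^{2\nu}\int_0^\infty e^{-tu}\,|2x+u|^{-2\nu-1}\,{}_2F_1\!\left(\nu+\tfrac12,\nu+\tfrac12;1;\frac{u(4\,\mathrm{Re}\,x+u)}{|2x+u|^2}\right)du .$$ (The argument of ${}_2F_1$ in the integrand is real and less than $1$.) -/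

import Mathlib

open Real Set Filter Topology MeasureTheory Asymptotics

/-- `IsHypBranch a b c U f`: the set `U` is an open neighbourhood of `0` that is star-shaped with
respect to `0`, and `f` is a holomorphic function on `U` that agrees near `0` with the
hypergeometric power series `∑ (a)ₙ (b)ₙ / (c)ₙ zⁿ / n!`. -/
def IsHypBranch (a b c : ℂ) (U : Set ℂ) (f : ℂ → ℂ) : Prop :=
  IsOpen U ∧ (0 : ℂ) ∈ U ∧ StarConvex ℝ 0 U ∧ DifferentiableOn ℂ f U ∧
    ∀ᶠ z in 𝓝 0, f z = ordinaryHypergeometric a b c z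

/-- Two such branches agree wherever both are defined. -/
theorem IsHypBranch.eq {a b c : ℂ} {U V : Set ℂ} {f g : ℂ → ℂ} (hf : IsHypBranch a b c U f)
    (hg : IsHypBranch a b c V g) {z : ℂ} (hU : z ∈ U) (hV : z ∈ V) : f z = g z := by
  obtain ⟨oU, zU, sU, dU, eU⟩ := hf
  obtain ⟨oV, zV, sV, dV, eV⟩ := hg
  have o := oU.inter oV
  have hc : IsPreconnected (U ∩ V) :=
    ((sU.inter sV).isPathConnected ⟨zU, zV⟩).isConnected.isPreconnected
  refine ((dU.mono inter_subset_left).analyticOnNhd o).eqOn_of_preconnected_of_eventuallyEq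
    ((dV.mono inter_subset_right).analyticOnNhd o) hc ⟨zU, zV⟩ ?_ ⟨hU, hV⟩
  filter_upwards [eU, eV] with w h1 h2
  rw [h1, h2]

open Classical in
/-- The principal branch of the Gauss hypergeometric function `₂F₁(a, b; c; z)`: the analytic
continuation of the hypergeometric series from `0` to `z` along the segment `[0, z]`, which is
possible for every `z ∈ ℂ \ [1, ∞)`. (The function `ordinaryHypergeometric` of Mathlib is only the
sum of the series, hence it has no meaning for `1 < |z|`.) The value `0` is used where there is no
such continuation. -/
noncomputable def hyp2F1 (a b c z : ℂ) : ℂ :=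
  if h : ∃ (U : Set ℂ) (f : ℂ → ℂ), IsHypBranch a b c U f ∧ z ∈ U then
    h.choose_spec.choose z
  else 0

/-- `hyp2F1` does not depend on choices. -/
theorem hyp2F1_eq {a b c : ℂ} {U : Set ℂ} {f : ℂ → ℂ} (hf : IsHypBranch a b c U f) {z : ℂ}
    (hz : z ∈ U) : hyp2F1 a b c z = f z := by
  have h : ∃ (U : Set ℂ) (f : ℂ → ℂ), IsHypBranch a b c U f ∧ z ∈ U := ⟨U, f, hf, hz⟩
  rw [hyp2F1, dif_pos h]
  exact h.choose_spec.choose_spec.1.eq hf h.choose_spec.choose_spec.2 hz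

/-- `IsBesselK ν f`: on the plane cut along `(-∞, 0]`, the function `f` is a holomorphic solution of
the modified Bessel equation `z² w'' + z w' - (z² + ν²) w = 0`, and it is the recessive solution
with the normalization `f(r) ~ √(π / (2 r)) e^{-r}` as `r → +∞`. These properties determine `f` on
the cut plane uniquely, see `IsBesselK.eqOn`. -/
def IsBesselK (ν : ℂ) (f : ℂ → ℂ) : Prop :=
  DifferentiableOn ℂ f Complex.slitPlane ∧
  (∀ z ∈ Complex.slitPlane,
    z ^ 2 * deriv (deriv f) z + z * deriv f z - (z ^ 2 + ν ^ 2) * f z = 0) ∧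
  (fun r : ℝ => f (r : ℂ)) ~[atTop] (fun r : ℝ => ((√(π / (2 * r)) * rexp (-r) : ℝ) : ℂ))

open Classical in
/-- The modified Bessel function of the second kind `K_ν` (principal branch, on the plane cut along
`(-∞, 0]`): the recessive solution at `+∞` of the modified Bessel equation, normalized by
`K_ν(r) ~ √(π / (2 r)) e^{-r}`. -/
noncomputable def besselK (ν z : ℂ) : ℂ :=
  if h : ∃ f : ℂ → ℂ, IsBesselK ν f then h.choose z else 0

/-- The Wronskian relation for the modified Bessel equation, along the positive half-line. -/
theorem IsBesselK.exists_wronskian {ν : ℂ} {f g : ℂ → ℂ} (hf : IsBesselK ν f)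
    (hg : IsBesselK ν g) : ∃ c : ℂ, ∀ r : ℝ, 0 < r →
      (r : ℂ) * (f r * deriv g r - deriv f r * g r) = c := by
  have key : ∀ z ∈ Complex.slitPlane, HasDerivAt
      (fun z => z * (f z * deriv g z - deriv f z * g z)) 0 z := by
    intro z hz
    have hn := Complex.isOpen_slitPlane.mem_nhds hz
    have f1 := (hf.1.differentiableAt hn).hasDerivAt
    have g1 := (hg.1.differentiableAt hn).hasDerivAt
    have f2 := ((hf.1.deriv Complex.isOpen_slitPlane).differentiableAt hn).hasDerivAt
    have g2 := ((hg.1.deriv Complex.isOpen_slitPlane).differentiableAt hn).hasDerivAt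
    have h := (hasDerivAt_id z).mul ((f1.mul g2).sub (f2.mul g1))
    refine h.congr_deriv ?_
    have z0 : z ≠ 0 := Complex.slitPlane_ne_zero hz
    have ef := hf.2.1 z hz
    have eg := hg.2.1 z hz
    apply mul_left_cancel₀ z0
    simp only [id, Pi.sub_apply, Pi.mul_apply]
    linear_combination f z * eg - g z * ef
  refine ⟨(1 : ℂ) * (f 1 * deriv g 1 - deriv f 1 * g 1), fun r hr => ?_⟩
  have hcv : IsPreconnected Complex.slitPlane :=
    (Complex.starConvex_one_slitPlane.isPathConnected (by simp)).isConnected.isPreconnected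
  have := Complex.isOpen_slitPlane.is_const_of_deriv_eq_zero hcv
    (fun z hz => (key z hz).differentiableAt.differentiableWithinAt)
    (fun z hz => (key z hz).deriv) (x := (r : ℂ)) (y := 1)
    (Complex.ofReal_mem_slitPlane.2 hr) (by simp)
  exact this

/-- The defining properties determine `K_ν` on the cut plane. -/
theorem IsBesselK.eqOn {ν : ℂ} {f g : ℂ → ℂ} (hf : IsBesselK ν f) (hg : IsBesselK ν g) :
    EqOn f g Complex.slitPlane := by
  obtain ⟨c, hc⟩ := hf.exists_wronskian hg
  have hA : ∀ r : ℝ, 0 < r → ((√(π / (2 * r)) * rexp (-r) : ℝ) : ℂ) ≠ 0 := by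
    intro r hr
    have : 0 < √(π / (2 * r)) * rexp (-r) := by positivity
    exact_mod_cast this.ne'
  have hA' : ∀ᶠ r : ℝ in atTop, ((√(π / (2 * r)) * rexp (-r) : ℝ) : ℂ) ≠ 0 := by
    filter_upwards [eventually_gt_atTop 0] with r hr using hA r hr
  have tf := (isEquivalent_iff_tendsto_one hA').1 hf.2.2
  have hfg : Tendsto (fun r : ℝ => g r / f r) atTop (𝓝 1) := by
    have hf0 : ∀ᶠ r : ℝ in atTop, f r ≠ 0 := by
      filter_upwards [tf.eventually_ne one_ne_zero] with r hr h0
      simp [h0] at hr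
    exact (isEquivalent_iff_tendsto_one hf0).1 (hg.2.2.trans hf.2.2.symm)
  -- the derivative of the quotient
  have hq : ∀ r : ℝ, 0 < r → f r ≠ 0 →
      HasDerivAt (fun r : ℝ => g r / f r) (c / (r * f r ^ 2)) r := by
    intro r hr h0
    have hn := Complex.isOpen_slitPlane.mem_nhds (Complex.ofReal_mem_slitPlane.2 hr)
    have f1 := (hf.1.differentiableAt hn).hasDerivAt
    have g1 := (hg.1.differentiableAt hn).hasDerivAt
    have h := (g1.div f1 h0).comp_ofReal
    refine h.congr_deriv ?_
    have r0 : (r : ℂ) ≠ 0 := by exact_mod_cast hr.ne'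
    rw [← hc r hr]
    field_simp
  -- a lower bound for the real part of `1 / (r f(r)^2)`
  have hlow : ∀ᶠ r : ℝ in atTop, 0 < r ∧ f r ≠ 0 ∧ (1 / π : ℝ) ≤ (1 / (r * f r ^ 2) : ℂ).re := by
    have t2 : Tendsto (fun r : ℝ => ((f r / ((√(π / (2 * r)) * rexp (-r) : ℝ) : ℂ)) ^ 2)⁻¹)
        atTop (𝓝 1) := by
      have h := (tf.pow 2).inv₀ (by simp)
      simpa using h
    have t3 : ∀ᶠ r : ℝ in atTop, (1 / 2 : ℝ) <
        (((f r / ((√(π / (2 * r)) * rexp (-r) : ℝ) : ℂ)) ^ 2)⁻¹).re := by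
      have := (Complex.continuous_re.tendsto 1).comp t2
      exact this.eventually_const_lt (by norm_num)
    filter_upwards [t3, eventually_gt_atTop 0, tf.eventually_ne one_ne_zero] with r h1 hr h2
    have h0 : f r ≠ 0 := by
      intro h0
      simp [h0] at h2
    refine ⟨hr, h0, ?_⟩
    have e : (1 / (r * f r ^ 2) : ℂ) = ((2 / π * rexp (2 * r) : ℝ) : ℂ) *
        ((f r / ((√(π / (2 * r)) * rexp (-r) : ℝ) : ℂ)) ^ 2)⁻¹ := by
      have hs : ((√(π / (2 * r)) * rexp (-r) : ℝ)) ^ 2 = π / (2 * r) * (rexp (2 * r))⁻¹ := by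
        rw [mul_pow, Real.sq_sqrt (by positivity), ← Real.exp_neg, ← Real.exp_nat_mul]
        congr 2
        push_cast
        ring
      have r0 : (r : ℂ) ≠ 0 := by exact_mod_cast hr.ne'
      have p0 : (π : ℂ) ≠ 0 := by exact_mod_cast Real.pi_ne_zero
      have e0 : ((rexp (2 * r) : ℝ) : ℂ) ≠ 0 := by exact_mod_cast (Real.exp_pos _).ne'
      rw [div_pow, ← Complex.ofReal_pow, hs]
      simp only [Complex.ofReal_mul, Complex.ofReal_div, Complex.ofReal_inv, Complex.ofReal_ofNat]
      field_simp
    rw [e, Complex.re_ofReal_mul]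
    have h4 : (1 : ℝ) ≤ rexp (2 * r) := Real.one_le_exp (by linarith)
    have h5 : 2 / π ≤ 2 / π * rexp (2 * r) := le_mul_of_one_le_right (by positivity) h4
    calc (1 / π : ℝ) = 2 / π * (1 / 2) := by ring
      _ ≤ _ := mul_le_mul h5 h1.le (by norm_num) (by positivity)
  obtain ⟨R, hR⟩ := eventually_atTop.1 hlow
  -- the Wronskian vanishes
  have hc0 : c = 0 := by
    by_contra hne
    set φ : ℝ → ℝ := fun r => (g r / f r / c).re with hφ
    have dφ : ∀ r, R ≤ r → HasDerivAt φ ((1 / (r * f r ^ 2) : ℂ).re) r := by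
      intro r hr
      have h := (hq r (hR r hr).1 (hR r hr).2.1).div_const c
      have h' := (Complex.reCLM.hasFDerivAt.comp_hasDerivAt r h)
      refine h'.congr_deriv ?_
      simp only [Complex.reCLM_apply]
      congr 1
      field_simp
    have lim : Tendsto φ atTop (𝓝 (1 / c).re) :=
      (Complex.continuous_re.tendsto _).comp (hfg.div_const c)
    have lim2 : Tendsto (fun r => φ (r + 1) - φ r) atTop (𝓝 0) := by
      have := (lim.comp (tendsto_atTop_add_const_right atTop (1 : ℝ) tendsto_id)).sub lim
      simpa using this
    have hlb : ∀ᶠ r in atTop, (1 / π : ℝ) ≤ φ (r + 1) - φ r := by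
      filter_upwards [eventually_ge_atTop R] with r hr
      obtain ⟨s, hs, e⟩ := exists_hasDerivAt_eq_slope φ (fun r => (1 / (r * f r ^ 2) : ℂ).re)
        (lt_add_one r)
        (fun s hs => (dφ s (hr.trans hs.1)).continuousAt.continuousWithinAt)
        (fun s hs => dφ s (hr.trans hs.1.le))
      have := (hR s (hr.trans hs.1.le)).2.2
      simp only [add_sub_cancel_left, div_one] at e
      rw [← e]
      exact this
    have := ge_of_tendsto lim2 hlb
    have : 0 < 1 / π := by positivity
    linarith
  -- so the quotient is constant for large `r`, equal to its limit
  have hconst : ∀ r, R ≤ r → g r / f r = 1 := by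
    intro r hr
    have hk : ∀ s, r ≤ s → g s / f s = g r / f r := by
      intro s hs
      refine constant_of_has_deriv_right_zero (f := fun r : ℝ => g r / f r) (a := r) (b := s)
        (fun u hu => ?_) (fun u hu => ?_) s (right_mem_Icc.2 hs)
      · have h := hR u (hr.trans hu.1)
        exact (hq u h.1 h.2.1).continuousAt.continuousWithinAt
      · have h := hR u (hr.trans hu.1)
        have h2 := hq u h.1 h.2.1
        rw [hc0, zero_div] at h2
        exact h2.hasDerivWithinAt
    have : Tendsto (fun s : ℝ => g s / f s) atTop (𝓝 (g r / f r)) := by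
      refine tendsto_const_nhds.congr' ?_
      filter_upwards [eventually_ge_atTop r] with s hs using (hk s hs).symm
    exact tendsto_nhds_unique this hfg
  have heq : ∀ r : ℝ, R ≤ r → f r = g r := by
    intro r hr
    have := hconst r hr
    rw [div_eq_one_iff_eq (hR r hr).2.1] at this
    exact this.symm
  have hcv : IsPreconnected Complex.slitPlane :=
    (Complex.starConvex_one_slitPlane.isPathConnected (by simp)).isConnected.isPreconnected
  have hmem : ((R + 1 : ℝ) : ℂ) ∈ Complex.slitPlane :=
    Complex.ofReal_mem_slitPlane.2 (by linarith [(hR R le_rfl).1])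
  refine (hf.1.analyticOnNhd Complex.isOpen_slitPlane).eqOn_of_preconnected_of_frequently_eq
    (hg.1.analyticOnNhd Complex.isOpen_slitPlane) hcv hmem ?_
  have ht : Tendsto (fun r : ℝ => (r : ℂ)) (𝓝[>] (R + 1)) (𝓝[≠] ((R + 1 : ℝ) : ℂ)) := by
    refine tendsto_nhdsWithin_iff.2
      ⟨(Complex.continuous_ofReal.tendsto _).mono_left nhdsWithin_le_nhds, ?_⟩
    filter_upwards [self_mem_nhdsWithin] with r hr
    simp only [mem_compl_iff, mem_singleton_iff]
    exact_mod_cast (ne_of_gt hr)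
  refine ht.frequently (Eventually.frequently ?_)
  filter_upwards [self_mem_nhdsWithin] with r hr
  have hr' : R + 1 < r := hr
  exact heq r (by linarith)

/-- `besselK` does not depend on choices. -/
theorem besselK_eq {ν : ℂ} {f : ℂ → ℂ} (hf : IsBesselK ν f) {z : ℂ}
    (hz : z ∈ Complex.slitPlane) : besselK ν z = f z := by
  have h : ∃ f : ℂ → ℂ, IsBesselK ν f := ⟨f, hf⟩
  rw [besselK, dif_pos h]
  exact h.choose_spec.eqOn hf hz

/-! Put `l = ν² - 1/4`, let `P` be the solution of `(m (1 + m) P')' = l P` that is holomorphic near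
`0` with `P 0 = 1`, and let `L(γ, β) = ∫₀^∞ e^{-u} P((1 + γ u) (1 + β u) - 1) du`. If `γ = 1/(2a)`,
the Legendre equation turns `a² (∂² - 2 ∂) - l` (in `a`), applied to the integrand, into an exact
`u`-derivative whose boundary values vanish (`hasDerivAt_legendreKernel_boundary`). So for each `b ≥
0` the function `a ↦ L(1/(2a), b)` solves the equation that `K_ν(a)` satisfies after division by
`√(π/(2a)) e^{-a}`.

These functions have finite limits as `a → +∞`, so uniqueness of the recessive solution makes them
proportional. This gives `K_ν(a) = √(π/(2a)) e^{-a} L(1/(2a), 0)` and the product formula `L(γ, b) =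
L(γ, 0) L(b, 0)` (`legendreLaplace_mul_ofReal`). The formula continues analytically from positive
`b` to a half-plane containing the conjugate of `γ` (`legendreLaplace_mul`); as `l` is real, `|L(γ,
0)|² = L(γ, conj γ)`. With `γ = 1/(2tx)`, the scaling `u ↦ t u` and the identity `₂F₁(a, a; 1; z) =
(1 - z)^{-a} P(z/(1 - z))`, `a = ν + 1/2`, this is the claim.

The analytic work is to keep the curve `(1 + γ u) (1 + β u)` off `(-∞, 0]`, locally uniformly in the
moving slope (`shiftedProd_mem_raySector`), and to show that `P` grows only polynomially along it
(`norm_legendreSol_le`), so that the integrals converge and can be differentiated. -/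

/-! ### Integrals depending holomorphically on a parameter -/

/-- A family of holomorphic functions on `U`, depending measurably on a parameter and locally
dominated by integrable functions of the parameter. -/
structure LocDominated {α : Type*} [MeasurableSpace α] (μ : Measure α) (U : Set ℂ)
    (F : ℂ → α → ℂ) : Prop where
  diff : ∀ᵐ u ∂μ, DifferentiableOn ℂ (fun z => F z u) U
  meas : ∀ z ∈ U, AEStronglyMeasurable (F z) μ
  dom : ∀ z ∈ U, ∃ ε > 0, ∃ g : α → ℝ, Integrable g μ ∧
    ∀ᵐ u ∂μ, ∀ w ∈ Metric.ball z ε, ‖F w u‖ ≤ g u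

namespace LocDominated

variable {α : Type*} [MeasurableSpace α] {μ : Measure α} {U : Set ℂ} {F : ℂ → α → ℂ}

theorem integrable (h : LocDominated μ U F) {z : ℂ} (hz : z ∈ U) : Integrable (F z) μ := by
  obtain ⟨ε, hε, g, hg, hb⟩ := h.dom z hz
  refine hg.mono' (h.meas z hz) ?_
  filter_upwards [hb] with u hu using hu z (Metric.mem_ball_self hε)

/-- Cauchy's estimate on small circles dominates the derivative. Closure under differentiation lets
a second-order equation be checked under the integral sign. -/
theorem deriv (h : LocDominated μ U F) (hU : IsOpen U) :
    LocDominated μ U (fun z u => deriv (fun z => F z u) z) where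
  diff := by
    filter_upwards [h.diff] with u hu using hu.deriv hU
  meas := by
    intro z hz
    obtain ⟨ε, hε, hball⟩ := Metric.isOpen_iff.1 hU z hz
    -- Steps of length at most `ε / 2` tending to `0`: the difference quotients along them transfer
    -- measurability to the derivative.
    set d : ℕ → ℂ := fun n => ((ε / 2 * (1 / ((n : ℝ) + 1)) : ℝ) : ℂ) with hd
    have hd0 : Tendsto d atTop (𝓝 0) := by
      have : Tendsto (fun n : ℕ => ε / 2 * (1 / ((n : ℝ) + 1))) atTop (𝓝 (ε / 2 * 0)) :=
        tendsto_one_div_add_atTop_nhds_zero_nat.const_mul _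
      rw [mul_zero] at this
      have h2 := (Complex.continuous_ofReal.tendsto 0).comp this
      simpa [hd, Function.comp_def] using h2
    have hdpos : ∀ n, d n ≠ 0 := by
      intro n
      have : 0 < ε / 2 * (1 / ((n : ℝ) + 1)) := by positivity
      exact Complex.ofReal_ne_zero.2 this.ne'
    have hmem : ∀ n, z + d n ∈ U := by
      intro n
      apply hball
      rw [Metric.mem_ball, dist_eq_norm, add_sub_cancel_left, hd, Complex.norm_real,
        Real.norm_of_nonneg (by positivity)]
      have : 1 / ((n : ℝ) + 1) ≤ 1 := by
        rw [div_le_one (by positivity)]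
        linarith [(Nat.cast_nonneg n : (0 : ℝ) ≤ n)]
      nlinarith
    refine aestronglyMeasurable_of_tendsto_ae atTop
      (f := fun n u => (d n)⁻¹ * (F (z + d n) u - F z u))
      (fun n => ((h.meas _ (hmem n)).sub (h.meas z hz)).const_mul _) ?_
    filter_upwards [h.diff] with u hu
    have hda := (hu.differentiableAt (hU.mem_nhds hz)).hasDerivAt
    have := hda.tendsto_slope_zero
    have h2 := this.comp (tendsto_nhdsWithin_iff.2 ⟨hd0, Eventually.of_forall fun n => hdpos n⟩)
    simpa [Function.comp_def] using h2
  dom := by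
    intro z hz
    obtain ⟨ε₁, hε₁, hball⟩ := Metric.isOpen_iff.1 hU z hz
    obtain ⟨ε₂, hε₂, g, hg, hb⟩ := h.dom z hz
    -- Circles of radius `r` around points of the `r`-ball at `z` stay inside both given balls.
    set r := min ε₁ ε₂ / 3 with hr
    have hr0 : 0 < r := by positivity
    have h1 : 3 * r ≤ ε₁ := by rw [hr]; linarith [min_le_left ε₁ ε₂]
    have h2 : 3 * r ≤ ε₂ := by rw [hr]; linarith [min_le_right ε₁ ε₂]
    refine ⟨r, hr0, fun u => g u / r, hg.div_const r, ?_⟩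
    filter_upwards [h.diff, hb] with u hu hbu w hw
    have hsub : Metric.closedBall w r ⊆ Metric.ball z (3 * r) := by
      intro y hy
      have e1 := Metric.mem_closedBall.1 hy
      have e2 := Metric.mem_ball.1 hw
      have := dist_triangle y w z
      rw [Metric.mem_ball]
      linarith
    refine Complex.norm_deriv_le_of_forall_mem_sphere_norm_le hr0 ?_ ?_
    · refine DifferentiableOn.diffContOnCl_ball ?_ (R := r) (U := Metric.closedBall w r) le_rfl
      exact hu.mono (hsub.trans ((Metric.ball_subset_ball h1).trans hball))
    · intro y hy
      exact hbu y (Metric.ball_subset_ball h2 (hsub (Metric.sphere_subset_closedBall hy)))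

theorem hasDerivAt (h : LocDominated μ U F) (hU : IsOpen U) {z : ℂ} (hz : z ∈ U) :
    HasDerivAt (fun z => ∫ u, F z u ∂μ) (∫ u, _root_.deriv (fun z => F z u) z ∂μ) z := by
  obtain ⟨ε, hε, g, hg, hb⟩ := (h.deriv hU).dom z hz
  obtain ⟨δ, hδ, hball⟩ := Metric.isOpen_iff.1 hU z hz
  have hn : Metric.ball z ε ∩ U ∈ 𝓝 z := inter_mem (Metric.ball_mem_nhds z hε) (hU.mem_nhds hz)
  refine (hasDerivAt_integral_of_dominated_loc_of_deriv_le
    (F' := fun z u => _root_.deriv (fun z => F z u) z) hn ?_ (h.integrable hz)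
    ((h.deriv hU).meas z hz) ?_ hg ?_).2
  · filter_upwards [hU.mem_nhds hz] with w hw using h.meas w hw
  · filter_upwards [hb] with u hu w hw using hu w hw.1
  · filter_upwards [h.diff] with u hu w hw
    exact (hu.differentiableAt (hU.mem_nhds hw.2)).hasDerivAt

theorem differentiableOn (h : LocDominated μ U F) (hU : IsOpen U) :
    DifferentiableOn ℂ (fun z => ∫ u, F z u ∂μ) U :=
  fun _ hz => (h.hasDerivAt hU hz).differentiableAt.differentiableWithinAt

theorem deriv_eqOn (h : LocDominated μ U F) (hU : IsOpen U) :
    EqOn (_root_.deriv fun z => ∫ u, F z u ∂μ)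
      (fun z => ∫ u, _root_.deriv (fun z => F z u) z ∂μ) U :=
  fun _ hz => (h.hasDerivAt hU hz).deriv

end LocDominated

/-! ### Means over segments from the origin -/

/-- The mean of `f` over the segment `[0, m]`. -/
noncomputable def rayMean (f : ℂ → ℂ) (m : ℂ) : ℂ := ∫ s in (0 : ℝ)..1, f (m * s)

theorem StarConvex.mul_ofReal_mem {U : Set ℂ} (hs : StarConvex ℝ 0 U) {m : ℂ} (hm : m ∈ U) {s : ℝ}
    (h : s ∈ Icc (0 : ℝ) 1) : m * s ∈ U := by
  have := hs.smul_mem hm h.1 h.2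
  rwa [Complex.real_smul, mul_comm] at this

theorem continuousOn_ray {U : Set ℂ} (hs : StarConvex ℝ 0 U) {f : ℂ → ℂ} (hf : ContinuousOn f U)
    {m : ℂ} (hm : m ∈ U) : ContinuousOn (fun s : ℝ => f (m * s)) (Icc 0 1) :=
  hf.comp (by fun_prop) fun _ h => hs.mul_ofReal_mem hm h

theorem locDominated_ray {U : Set ℂ} (hU : IsOpen U) (hs : StarConvex ℝ 0 U) {f : ℂ → ℂ}
    (hf : DifferentiableOn ℂ f U) :
    LocDominated (volume.restrict (Ioc (0 : ℝ) 1)) U (fun m s => f (m * s)) where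
  diff := by
    filter_upwards [ae_restrict_mem measurableSet_Ioc] with s h
    exact hf.comp (by fun_prop) fun m hm => hs.mul_ofReal_mem hm (Ioc_subset_Icc_self h)
  meas := fun m hm => ((continuousOn_ray hs hf.continuousOn hm).mono
    Ioc_subset_Icc_self).aestronglyMeasurable measurableSet_Ioc
  dom := by
    intro z hz
    obtain ⟨ε, hε, hb⟩ := Metric.nhds_basis_closedBall.mem_iff.1 (hU.mem_nhds hz)
    have hK : IsCompact ((fun p : ℂ × ℝ => p.1 * (p.2 : ℂ)) '' (Metric.closedBall z ε ×ˢ Icc 0 1)) :=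
      ((isCompact_closedBall z ε).prod isCompact_Icc).image (by fun_prop)
    obtain ⟨C, hC⟩ := hK.exists_bound_of_continuousOn (f := f) (hf.continuousOn.mono (by
      rintro _ ⟨⟨a, b⟩, ⟨h1, h2⟩, rfl⟩
      exact hs.mul_ofReal_mem (hb h1) h2))
    refine ⟨ε, hε, fun _ => C, integrable_const C, ?_⟩
    filter_upwards [ae_restrict_mem measurableSet_Ioc] with s h w hw
    exact hC _ ⟨(w, s), ⟨Metric.ball_subset_closedBall hw, Ioc_subset_Icc_self h⟩, rfl⟩

theorem rayMean_eq (f : ℂ → ℂ) : rayMean f = fun m => ∫ s in Ioc (0 : ℝ) 1, f (m * s) := by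
  funext m
  rw [rayMean, intervalIntegral.integral_of_le zero_le_one]

theorem DifferentiableOn.rayMean {U : Set ℂ} (hU : IsOpen U) (hs : StarConvex ℝ 0 U) {f : ℂ → ℂ}
    (hf : DifferentiableOn ℂ f U) : DifferentiableOn ℂ (rayMean f) U := by
  rw [rayMean_eq]
  exact (locDominated_ray hU hs hf).differentiableOn hU

/-- `m ↦ m * rayMean f m` is a primitive of `f`. -/
theorem hasDerivAt_mul_rayMean {U : Set ℂ} (hU : IsOpen U) (hs : StarConvex ℝ 0 U) {f : ℂ → ℂ}
    (hf : DifferentiableOn ℂ f U) {m : ℂ} (hm : m ∈ U) :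
    HasDerivAt (fun m => m * rayMean f m) (f m) m := by
  have hL := locDominated_ray hU hs hf
  have h1 := hL.hasDerivAt hU hm
  rw [← rayMean_eq] at h1
  refine ((hasDerivAt_id m).mul h1).congr_deriv ?_
  have hd : ∀ s ∈ Icc (0 : ℝ) 1, HasDerivAt f (_root_.deriv f (m * s)) (m * s) := fun s h =>
    (hf.differentiableAt (hU.mem_nhds (hs.mul_ofReal_mem hm h))).hasDerivAt
  have e1 : ∫ s in Ioc (0 : ℝ) 1, _root_.deriv (fun z => f (z * s)) m =
      ∫ s in (0 : ℝ)..1, s * _root_.deriv f (m * s) := by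
    rw [intervalIntegral.integral_of_le zero_le_one]
    refine setIntegral_congr_fun measurableSet_Ioc fun s h => ?_
    have := (hd s (Ioc_subset_Icc_self h)).comp m ((hasDerivAt_id m).mul_const (s : ℂ))
    rw [show (fun z => f (z * s)) = f ∘ fun z => id z * (s : ℂ) from rfl, this.deriv]
    simp [mul_comm]
  have c1 := continuousOn_ray hs hf.continuousOn hm
  have c2 := continuousOn_ray hs (hf.deriv hU).continuousOn hm
  have i1 : IntervalIntegrable (fun s : ℝ => f (m * s)) volume 0 1 :=
    c1.intervalIntegrable_of_Icc zero_le_one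
  have c3 : ContinuousOn (fun s : ℝ => (s : ℂ) * _root_.deriv f (m * s)) (Icc 0 1) :=
    (Complex.continuous_ofReal.continuousOn).mul c2
  have i3 : IntervalIntegrable (fun s : ℝ => (s : ℂ) * _root_.deriv f (m * s)) volume 0 1 :=
    c3.intervalIntegrable_of_Icc zero_le_one
  have e2 := intervalIntegral.integral_eq_sub_of_hasDerivAt (a := 0) (b := 1)
    (f := fun s : ℝ => (s : ℂ) * f (m * s))
    (f' := fun s : ℝ => f (m * s) + m * ((s : ℂ) * _root_.deriv f (m * s))) (fun s h => by
      rw [uIcc_of_le zero_le_one] at h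
      have h2 : HasDerivAt (fun z : ℂ => z * f (m * z))
          (f (m * s) + m * ((s : ℂ) * _root_.deriv f (m * s))) (s : ℂ) := by
        have := (hasDerivAt_id (s : ℂ)).mul
          ((hd s h).comp (s : ℂ) ((hasDerivAt_id (s : ℂ)).const_mul m))
        refine this.congr_deriv ?_
        simp
        ring
      exact h2.comp_ofReal) (i1.add (i3.const_mul m))
  rw [intervalIntegral.integral_add i1 (i3.const_mul m), intervalIntegral.integral_const_mul] at e2
  simp only [id, one_mul]
  rw [e1, rayMean, e2]
  simp

theorem norm_rayMean_le {f : ℂ → ℂ} {m : ℂ} {g : ℝ → ℝ} (hg : IntervalIntegrable g volume 0 1)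
    (h : ∀ s ∈ Icc (0 : ℝ) 1, ‖f (m * s)‖ ≤ g s) : ‖rayMean f m‖ ≤ ∫ s in (0 : ℝ)..1, g s :=
  intervalIntegral.norm_integral_le_of_norm_le zero_le_one
    (Eventually.of_forall fun s hs => h s (Ioc_subset_Icc_self hs)) hg

theorem norm_rayMean_le_const {f : ℂ → ℂ} {m : ℂ} {C : ℝ}
    (h : ∀ s ∈ Icc (0 : ℝ) 1, ‖f (m * s)‖ ≤ C) : ‖rayMean f m‖ ≤ C := by
  have := norm_rayMean_le (g := fun _ => C) intervalIntegrable_const h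
  simpa using this

theorem rayMean_conj {f : ℂ → ℂ} (h : ∀ m, f (starRingEnd ℂ m) = starRingEnd ℂ (f m)) (m : ℂ) :
    rayMean f (starRingEnd ℂ m) = starRingEnd ℂ (rayMean f m) := by
  simp only [rayMean_eq]
  rw [← integral_conj]
  congr 1
  funext s
  rw [← h]
  simp

theorem hasSum_rayMean {f : ℕ → ℂ → ℂ} {m : ℂ} {u : ℕ → ℝ} (hu : Summable u)
    (hc : ∀ n, ContinuousOn (fun s : ℝ => f n (m * s)) (Icc 0 1))
    (hb : ∀ n, ∀ s ∈ Icc (0 : ℝ) 1, ‖f n (m * s)‖ ≤ u n) :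
    HasSum (fun n => rayMean (f n) m) (rayMean (fun m => ∑' n, f n m) m) := by
  refine intervalIntegral.hasSum_integral_of_dominated_convergence (fun n _ => u n) ?_ ?_ ?_ ?_ ?_
  · intro n
    rw [uIoc_of_le zero_le_one]
    exact ((hc n).mono Ioc_subset_Icc_self).aestronglyMeasurable measurableSet_Ioc
  · intro n
    refine Eventually.of_forall fun s hs => hb n s ?_
    rw [uIoc_of_le zero_le_one] at hs
    exact Ioc_subset_Icc_self hs
  · exact Eventually.of_forall fun s _ => hu
  · exact intervalIntegrable_const
  · refine Eventually.of_forall fun s hs => ?_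
    rw [uIoc_of_le zero_le_one] at hs
    exact (Summable.of_norm_bounded hu fun n => hb n s (Ioc_subset_Icc_self hs)).hasSum

/-! ### The cut plane and its uniform subregions -/

/-- The plane cut along `(-∞, -1]`. -/
def cutPlane : Set ℂ := {m | 1 + m ∈ Complex.slitPlane}

theorem isOpen_cutPlane : IsOpen cutPlane :=
  Complex.isOpen_slitPlane.preimage (by fun_prop)

theorem one_add_ne_zero_of_mem_cutPlane {m : ℂ} (h : m ∈ cutPlane) : 1 + m ≠ 0 :=
  Complex.slitPlane_ne_zero h

theorem starConvex_cutPlane : StarConvex ℝ 0 cutPlane := by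
  refine starConvex_zero_iff.2 fun m hm s h0 h1 => ?_
  have := Complex.starConvex_one_slitPlane.add_smul_sub_mem hm h0 h1
  rwa [add_sub_cancel_left] at this

/-- The set of all `m` such that `1 + t m` is comparable to `1 + t |m|` along the segment `[0, m]`,
with constant `c`. -/
def raySector (c : ℝ) : Set ℂ := {m | ∀ t ∈ Icc (0 : ℝ) 1, c * (1 + t * ‖m‖) ≤ ‖1 + t * m‖}

theorem mul_ofReal_mem_raySector {c : ℝ} {m : ℂ} (hm : m ∈ raySector c) {s : ℝ}
    (hs : s ∈ Icc (0 : ℝ) 1) : m * s ∈ raySector c := by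
  intro t ht
  have := hm (t * s) ⟨mul_nonneg ht.1 hs.1, mul_le_one₀ ht.2 hs.1 hs.2⟩
  rw [norm_mul, Complex.norm_real, Real.norm_of_nonneg hs.1]
  push_cast at this
  convert this using 3 <;> ring

theorem raySector_subset {c : ℝ} (hc : 0 < c) : raySector c ⊆ cutPlane := by
  intro m hm
  by_contra h
  rw [cutPlane, mem_ofPred_eq, Complex.mem_slitPlane_iff, not_or] at h
  simp only [Complex.add_re, Complex.one_re, not_lt, Complex.add_im, Complex.one_im, zero_add,
    not_not] at h
  have hre : m.re ≤ -1 := by linarith [h.1]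
  have hm0 : m = (m.re : ℂ) := Complex.ext (by simp) (by simp [h.2])
  have h1 : 0 < (-m.re) := by linarith
  -- For `m` on the cut, the segment `[0, m]` passes through `-1` at this parameter, so `1 + t m`
  -- vanishes there.
  have := hm ((-m.re)⁻¹) ⟨by positivity, inv_le_one_of_one_le₀ (by linarith)⟩
  rw [hm0] at this
  have e : (1 : ℂ) + (((-(m.re : ℂ).re)⁻¹ : ℝ) : ℂ) * (m.re : ℂ) = 0 := by
    have : m.re ≠ 0 := by linarith
    have h3 : (m.re : ℂ) ≠ 0 := by exact_mod_cast this
    simp only [Complex.ofReal_re]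
    push_cast
    field_simp
    ring
  rw [e, norm_zero] at this
  have h5 : 0 < (-(m.re : ℂ).re)⁻¹ := by simpa using h1
  have : 0 < c * (1 + (-(m.re : ℂ).re)⁻¹ * ‖(m.re : ℂ)‖) := by positivity
  linarith

/-- By compactness `|1 + t m|` has a positive minimum `δ` on `[0, 1]`; moving `m` by less than `δ /
2` costs at most half of it. This supplies the local uniformity for the series below. -/
theorem exists_ball_subset_raySector {m : ℂ} (hm : m ∈ cutPlane) :
    ∃ ε > 0, ∃ c > 0, Metric.ball m ε ⊆ raySector c := by
  have hc : ContinuousOn (fun t : ℝ => ‖1 + (t : ℂ) * m‖) (Icc 0 1) := by fun_prop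
  obtain ⟨t₀, ht₀, hmin⟩ := isCompact_Icc.exists_isMinOn ⟨0, by simp⟩ hc
  set δ := ‖1 + (t₀ : ℂ) * m‖ with hδ
  have hδ0 : 0 < δ := by
    rw [hδ, norm_pos_iff, mul_comm]
    exact one_add_ne_zero_of_mem_cutPlane (starConvex_cutPlane.mul_ofReal_mem hm ht₀)
  refine ⟨δ / 2, by positivity, δ / 2 / (1 + (‖m‖ + δ / 2)), by positivity, ?_⟩
  intro w hw t ht
  rw [Metric.mem_ball, dist_eq_norm] at hw
  have h1 : δ ≤ ‖1 + (t : ℂ) * m‖ := hmin ht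
  have h2 : ‖1 + (t : ℂ) * m‖ ≤ ‖1 + (t : ℂ) * w‖ + ‖(t : ℂ) * (w - m)‖ := by
    have : (1 : ℂ) + t * m = (1 + t * w) - t * (w - m) := by ring
    rw [this]
    exact norm_sub_le _ _
  have h3 : ‖(t : ℂ) * (w - m)‖ ≤ δ / 2 := by
    rw [norm_mul, Complex.norm_real, Real.norm_of_nonneg ht.1]
    have := mul_le_mul ht.2 hw.le (norm_nonneg _) zero_le_one
    linarith
  have h4 : ‖w‖ ≤ ‖m‖ + δ / 2 := by
    have : w = m + (w - m) := by ring
    calc ‖w‖ = ‖m + (w - m)‖ := by rw [← this]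
      _ ≤ _ := (norm_add_le _ _).trans (by linarith)
  have h5 : t * ‖w‖ ≤ ‖m‖ + δ / 2 := by
    have := mul_le_mul ht.2 h4 (norm_nonneg _) zero_le_one
    linarith
  have h6 : δ / 2 / (1 + (‖m‖ + δ / 2)) * (1 + t * ‖w‖) ≤ δ / 2 := by
    rw [div_mul_eq_mul_div, div_le_iff₀ (by positivity)]
    gcongr
  linarith

/-! ### The Legendre equation solved by a Neumann series -/

/-- The Volterra operator whose fixed point equation `p = 1 + T p` is equivalent to the Legendre
equation `(m (1 + m) p')' = l p` with `p 0 = 1`. -/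
noncomputable def legendreVolterra (l : ℂ) (f : ℂ → ℂ) (m : ℂ) : ℂ :=
  m * rayMean (fun w => l * rayMean f w / (1 + w)) m

theorem differentiableOn_rayMean_div {l : ℂ} {f : ℂ → ℂ} (hf : DifferentiableOn ℂ f cutPlane) :
    DifferentiableOn ℂ (fun w => l * rayMean f w / (1 + w)) cutPlane :=
  ((hf.rayMean isOpen_cutPlane starConvex_cutPlane).const_mul l).div (by fun_prop)
    fun _ hw => one_add_ne_zero_of_mem_cutPlane hw

theorem hasDerivAt_legendreVolterra {l : ℂ} {f : ℂ → ℂ} (hf : DifferentiableOn ℂ f cutPlane)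
    {m : ℂ} (hm : m ∈ cutPlane) :
    HasDerivAt (legendreVolterra l f) (l * rayMean f m / (1 + m)) m :=
  hasDerivAt_mul_rayMean isOpen_cutPlane starConvex_cutPlane (differentiableOn_rayMean_div hf) hm

/-- The terms of the Neumann series of `legendreVolterra`. -/
noncomputable def legendreTerm (l : ℂ) : ℕ → ℂ → ℂ
  | 0 => fun _ => 1
  | n + 1 => legendreVolterra l (legendreTerm l n)

theorem differentiableOn_legendreTerm (l : ℂ) (n : ℕ) :
    DifferentiableOn ℂ (legendreTerm l n) cutPlane := by
  induction n with
  | zero => exact differentiableOn_const _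
  | succ n ih =>
    exact fun m hm => (hasDerivAt_legendreVolterra ih hm).differentiableAt.differentiableWithinAt

theorem le_norm_one_add_of_mem_raySector {c : ℝ} {m : ℂ} (hm : m ∈ raySector c) :
    c * (1 + ‖m‖) ≤ ‖1 + m‖ := by
  simpa using hm 1 (by simp)

/-- Each application of the operator contributes a factor `‖l‖ / c * ‖m‖`, from `c ≤ |1 + m s|`, and
integrating `s ^ n` contributes `1 / (n + 1)`. -/
theorem norm_legendreTerm_le {l : ℂ} {c : ℝ} (hc : 0 < c) (n : ℕ) {m : ℂ} (hm : m ∈ raySector c) :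
    ‖legendreTerm l n m‖ ≤ (‖l‖ / c * ‖m‖) ^ n / n.factorial := by
  induction n generalizing m with
  | zero => simp [legendreTerm]
  | succ n ih =>
    have key : ∀ s ∈ Icc (0 : ℝ) 1, ‖l * rayMean (legendreTerm l n) (m * s) / (1 + m * s)‖ ≤
        ‖l‖ / c * ((‖l‖ / c * ‖m‖) ^ n / n.factorial) * s ^ n := by
      intro s hs
      have hms := mul_ofReal_mem_raySector hm hs
      have h1 : ‖rayMean (legendreTerm l n) (m * s)‖ ≤ (‖l‖ / c * (‖m‖ * s)) ^ n / n.factorial := by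
        refine norm_rayMean_le_const fun r hr => (ih (mul_ofReal_mem_raySector hms hr)).trans ?_
        rw [norm_mul, norm_mul, Complex.norm_real, Complex.norm_real, Real.norm_of_nonneg hs.1,
          Real.norm_of_nonneg hr.1]
        have hs0 : 0 ≤ s := hs.1
        have hr0 : 0 ≤ r := hr.1
        have : ‖m‖ * s * r ≤ ‖m‖ * s := mul_le_of_le_one_right (by positivity) hr.2
        gcongr
      have h2 : c ≤ ‖1 + m * s‖ := by
        refine le_trans ?_ (le_norm_one_add_of_mem_raySector hms)
        nlinarith [norm_nonneg (m * s)]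
      rw [norm_div, norm_mul]
      have hs0 : 0 ≤ s := hs.1
      calc ‖l‖ * ‖rayMean (legendreTerm l n) (m * s)‖ / ‖1 + m * s‖
          ≤ ‖l‖ * ((‖l‖ / c * (‖m‖ * s)) ^ n / n.factorial) / c := by gcongr
        _ = _ := by rw [← mul_assoc, mul_pow _ s]; ring
    rw [legendreTerm, legendreVolterra, norm_mul]
    have h3 := norm_rayMean_le (m := m) (f := fun w => l * rayMean (legendreTerm l n) w / (1 + w))
      ((Continuous.intervalIntegrable (by fun_prop) 0 1)) key
    rw [intervalIntegral.integral_const_mul, integral_pow] at h3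
    refine (mul_le_mul_of_nonneg_left h3 (norm_nonneg m)).trans (le_of_eq ?_)
    rw [Nat.factorial_succ, one_pow, zero_pow n.succ_ne_zero, pow_succ]
    push_cast
    generalize ‖l‖ / c = K
    field_simp
    ring

/-- The solution of the Legendre equation `(m (1 + m) p')' = l p` that is holomorphic on the plane
cut along `(-∞, -1]` and satisfies `p 0 = 1`. With `l = ν² - 1/4` this is the Legendre function
`P_{ν-1/2}(1 + 2 m)`. -/
noncomputable def legendreSol (l : ℂ) (m : ℂ) : ℂ := ∑' n, legendreTerm l n m

theorem summable_legendreBound (r : ℝ) : Summable fun n : ℕ => r ^ n / n.factorial :=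
  Real.summable_pow_div_factorial r

theorem legendreSol_zero (l : ℂ) : legendreSol l 0 = 1 := by
  rw [legendreSol, tsum_eq_single 0]
  · rfl
  · intro n hn
    obtain ⟨k, rfl⟩ := Nat.exists_eq_succ_of_ne_zero hn
    simp [legendreTerm, legendreVolterra]

theorem rayMean_legendreSol_hasSum {l : ℂ} {m : ℂ} (hm : m ∈ cutPlane) :
    HasSum (fun n => rayMean (legendreTerm l n) m) (rayMean (legendreSol l) m) := by
  obtain ⟨ε, hε, c, hc, hb⟩ := exists_ball_subset_raySector hm
  have hm' := hb (Metric.mem_ball_self hε)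
  refine hasSum_rayMean (summable_legendreBound (‖l‖ / c * ‖m‖))
    (fun n => continuousOn_ray starConvex_cutPlane (differentiableOn_legendreTerm l n).continuousOn
      hm) fun n s hs => ?_
  refine (norm_legendreTerm_le hc n (mul_ofReal_mem_raySector hm' hs)).trans ?_
  rw [norm_mul, Complex.norm_real, Real.norm_of_nonneg hs.1]
  have : 0 ≤ s := hs.1
  gcongr
  exact mul_le_of_le_one_right (by positivity) hs.2

/-- The once integrated Legendre equation. The mean absorbs the factor `m` of `m (1 + m) p' = l ∫
p`, so nothing is singular at `0`. -/
theorem hasDerivAt_legendreSol {l : ℂ} {m : ℂ} (hm : m ∈ cutPlane) :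
    HasDerivAt (legendreSol l) (l * rayMean (legendreSol l) m / (1 + m)) m := by
  obtain ⟨ε, hε, c, hc, hb⟩ := exists_ball_subset_raySector hm
  have hu := summable_legendreBound (‖l‖ / c * (‖m‖ + ε))
  have hd : ∀ n, DifferentiableOn ℂ (legendreTerm l n) (Metric.ball m ε) := fun n =>
    (differentiableOn_legendreTerm l n).mono (hb.trans (raySector_subset hc))
  have hle : ∀ n, ∀ w ∈ Metric.ball m ε,
      ‖legendreTerm l n w‖ ≤ (‖l‖ / c * (‖m‖ + ε)) ^ n / n.factorial := by
    intro n w hw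
    refine (norm_legendreTerm_le hc n (hb hw)).trans ?_
    have : ‖w‖ ≤ ‖m‖ + ε := by
      have h := norm_le_norm_add_norm_sub' w m
      rw [Metric.mem_ball, dist_eq_norm] at hw
      linarith
    gcongr
  have h1 := Complex.hasSum_deriv_of_summable_norm hu hd Metric.isOpen_ball hle
    (Metric.mem_ball_self hε)
  have h2 := Complex.differentiableOn_tsum_of_summable_norm hu hd Metric.isOpen_ball hle
  have h3 := (h2.differentiableAt (Metric.isOpen_ball.mem_nhds (Metric.mem_ball_self hε))).hasDerivAt
  refine h3.congr_deriv (h1.unique ?_)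
  have h4 := ((rayMean_legendreSol_hasSum (l := l) hm).mul_left l).div_const (1 + m)
  rw [← hasSum_nat_add_iff' 1] at h1
  have e0 : _root_.deriv (legendreTerm l 0) m = 0 := by
    rw [show legendreTerm l 0 = fun _ => 1 from rfl, deriv_const]
  have e1 : ∀ n, _root_.deriv (legendreTerm l (n + 1)) m =
      l * rayMean (legendreTerm l n) m / (1 + m) := fun n =>
    (hasDerivAt_legendreVolterra (differentiableOn_legendreTerm l n) hm).deriv
  -- The zeroth term is constant, so the differentiated series starts at index `1`, where it becomes
  -- the series `h4`.
  rw [← hasSum_nat_add_iff' 1]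
  simpa [e0, e1] using h4

theorem differentiableOn_legendreSol (l : ℂ) : DifferentiableOn ℂ (legendreSol l) cutPlane :=
  fun _ hm => (hasDerivAt_legendreSol hm).differentiableAt.differentiableWithinAt

theorem deriv_legendreSol {l : ℂ} {m : ℂ} (hm : m ∈ cutPlane) :
    deriv (legendreSol l) m = l * rayMean (legendreSol l) m / (1 + m) :=
  (hasDerivAt_legendreSol hm).deriv

theorem hasDerivAt_deriv_legendreSol (l : ℂ) {m : ℂ} (hm : m ∈ cutPlane) :
    HasDerivAt (deriv (legendreSol l)) (deriv (deriv (legendreSol l)) m) m :=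
  (((differentiableOn_legendreSol l).deriv isOpen_cutPlane).differentiableAt
    (isOpen_cutPlane.mem_nhds hm)).hasDerivAt

/-- The Legendre equation. -/
theorem legendreSol_ode (l : ℂ) {m : ℂ} (hm : m ∈ cutPlane) :
    m * (1 + m) * deriv (deriv (legendreSol l)) m + (1 + 2 * m) * deriv (legendreSol l) m =
      l * legendreSol l m := by
  have h1 : HasDerivAt (fun m => m * (1 + m) * deriv (legendreSol l) m)
      ((1 + 2 * m) * deriv (legendreSol l) m + m * (1 + m) * deriv (deriv (legendreSol l)) m) m := by
    have := ((hasDerivAt_id m).mul ((hasDerivAt_id m).const_add 1)).mul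
      (hasDerivAt_deriv_legendreSol l hm)
    refine this.congr_deriv ?_
    change (1 * (1 + m) + m * 1) * _ + m * (1 + m) * _ = _
    ring
  have h2 := (hasDerivAt_mul_rayMean isOpen_cutPlane starConvex_cutPlane
    (differentiableOn_legendreSol l) hm).const_mul l
  have h3 : (fun m => m * (1 + m) * deriv (legendreSol l) m) =ᶠ[𝓝 m]
      fun m => l * (m * rayMean (legendreSol l) m) := by
    filter_upwards [isOpen_cutPlane.mem_nhds hm] with w hw
    rw [deriv_legendreSol hw]
    have := one_add_ne_zero_of_mem_cutPlane hw
    field_simp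
  have := h1.unique (h2.congr_of_eventuallyEq h3)
  rw [← this]
  ring

theorem legendreTerm_conj (l : ℝ) (n : ℕ) (m : ℂ) :
    legendreTerm l n (starRingEnd ℂ m) = starRingEnd ℂ (legendreTerm l n m) := by
  induction n generalizing m with
  | zero => simp [legendreTerm]
  | succ n ih =>
    rw [legendreTerm, legendreVolterra, legendreVolterra, rayMean_conj, map_mul]
    intro w
    rw [rayMean_conj ih]
    simp

theorem legendreSol_conj (l : ℝ) (m : ℂ) :
    legendreSol l (starRingEnd ℂ m) = starRingEnd ℂ (legendreSol l m) := by
  simp only [legendreSol, legendreTerm_conj, Complex.conj_tsum]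

/-! ### Polynomial growth of the Legendre function -/

theorem legendreSol_eq_one_add (l : ℂ) {m : ℂ} (hm : m ∈ cutPlane) :
    legendreSol l m = 1 + m * rayMean (deriv (legendreSol l)) m := by
  have hd := (differentiableOn_legendreSol l).deriv isOpen_cutPlane
  have h := intervalIntegral.integral_eq_sub_of_hasDerivAt (a := 0) (b := 1)
    (f := fun s : ℝ => legendreSol l (m * s))
    (f' := fun s : ℝ => m * deriv (legendreSol l) (m * s)) (fun s hs => by
      rw [uIcc_of_le zero_le_one] at hs
      have h1 := ((differentiableOn_legendreSol l).differentiableAt (isOpen_cutPlane.mem_nhds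
        (starConvex_cutPlane.mul_ofReal_mem hm hs))).hasDerivAt
      have h2 := h1.comp (s : ℂ) ((hasDerivAt_id (s : ℂ)).const_mul m)
      have h3 := h2.comp_ofReal
      refine h3.congr_deriv ?_
      simp [mul_comm])
    (((continuousOn_ray starConvex_cutPlane hd.continuousOn hm).const_mul
      m).intervalIntegrable_of_Icc zero_le_one)
  rw [intervalIntegral.integral_const_mul] at h
  rw [rayMean, h]
  simp [legendreSol_zero]

/-- The termwise bounds only give exponential growth, too weak for a Laplace transform at `1`.
Instead, a bound `|p| ≤ ρ (1 + |m|)^(N+1)` on a segment is reproduced by the integrated equation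
with `1 + ρ ((1 + |m|)^(N+1) - 1)`; at a point where the best `ρ` is attained this forces `ρ ≤ 1`.
-/
theorem norm_legendreSol_le {l : ℂ} {c : ℝ} (hc : 0 < c) {N : ℕ} (hN : ‖l‖ / c ≤ N + 1) {m : ℂ}
    (hm : m ∈ raySector c) : ‖legendreSol l m‖ ≤ (1 + ‖m‖) ^ (N + 1) := by
  have hcont : ContinuousOn (fun s : ℝ => ‖legendreSol l (m * s)‖ / (1 + s * ‖m‖) ^ (N + 1))
      (Icc 0 1) := by
    refine (continuousOn_ray starConvex_cutPlane (differentiableOn_legendreSol l).continuousOn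
      (raySector_subset hc hm)).norm.div (by fun_prop) fun s hs => ?_
    have : 0 ≤ s := hs.1
    positivity
  obtain ⟨s₀, hs₀, hmax⟩ := isCompact_Icc.exists_isMaxOn ⟨0, by simp⟩ hcont
  set ρ := ‖legendreSol l (m * s₀)‖ / (1 + s₀ * ‖m‖) ^ (N + 1) with hρ
  have hs₀' : 0 ≤ s₀ := hs₀.1
  have hρ0 : 0 ≤ ρ := by positivity
  set m₀ := m * s₀ with hm₀
  have hm₀s := mul_ofReal_mem_raySector hm hs₀
  rw [← hm₀] at hm₀s
  have hy : ‖m₀‖ = s₀ * ‖m‖ := by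
    rw [hm₀, norm_mul, Complex.norm_real, Real.norm_of_nonneg hs₀', mul_comm]
  set y := ‖m₀‖ with hydef
  have hy0 : 0 ≤ y := norm_nonneg _
  have hb : ∀ s ∈ Icc (0 : ℝ) 1, ‖legendreSol l (m₀ * s)‖ ≤ ρ * (1 + s * y) ^ (N + 1) := by
    intro s hs
    have h0 : 0 ≤ s := hs.1
    have := hmax (a := s₀ * s) ⟨mul_nonneg hs₀' h0, mul_le_one₀ hs₀.2 h0 hs.2⟩
    simp only [mem_ofPred_eq] at this
    rw [div_le_iff₀ (by positivity)] at this
    rw [hy, hm₀, mul_assoc, ← Complex.ofReal_mul, ← mul_assoc s, mul_comm s]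
    exact this
  have hd : ∀ s ∈ Icc (0 : ℝ) 1, ‖deriv (legendreSol l) (m₀ * s)‖ ≤
      (N + 1) * ρ * (1 + s * y) ^ N := by
    intro s hs
    have h0 : 0 ≤ s := hs.1
    have hms := mul_ofReal_mem_raySector hm₀s hs
    rw [deriv_legendreSol (raySector_subset hc hms), norm_div, norm_mul]
    have h1 : ‖rayMean (legendreSol l) (m₀ * s)‖ ≤ ρ * (1 + s * y) ^ (N + 1) := by
      refine norm_rayMean_le_const fun r hr => ?_
      have hr0 : 0 ≤ r := hr.1
      have := hb (s * r) ⟨mul_nonneg h0 hr0, mul_le_one₀ hs.2 hr0 hr.2⟩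
      push_cast at this
      rw [← mul_assoc] at this
      refine this.trans ?_
      gcongr
      exact mul_le_of_le_one_right h0 hr.2
    have h2 : c * (1 + s * y) ≤ ‖1 + m₀ * s‖ := by
      have := hm₀s s hs
      rwa [mul_comm (s : ℂ)] at this
    have hpos : 0 < 1 + s * y := by positivity
    calc ‖l‖ * ‖rayMean (legendreSol l) (m₀ * s)‖ / ‖1 + m₀ * s‖
        ≤ ‖l‖ * (ρ * (1 + s * y) ^ (N + 1)) / (c * (1 + s * y)) := by gcongr
      _ = ‖l‖ / c * (ρ * (1 + s * y) ^ N) := by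
        rw [pow_succ]
        field_simp
      -- The exponent `N + 1` is chosen so that it dominates `‖l‖ / c`; the bound then integrates
      -- exactly to `hint`.
      _ ≤ (N + 1) * (ρ * (1 + s * y) ^ N) := by gcongr
      _ = _ := by ring
  have hint : ∫ s in (0 : ℝ)..1, y * ((N + 1) * (1 + s * y) ^ N) = (1 + y) ^ (N + 1) - 1 := by
    have := intervalIntegral.integral_eq_sub_of_hasDerivAt (a := 0) (b := 1)
      (f := fun s : ℝ => (1 + s * y) ^ (N + 1))
      (f' := fun s : ℝ => y * ((N + 1) * (1 + s * y) ^ N)) (fun s _ => by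
        refine ((((hasDerivAt_id s).mul_const y).const_add 1).pow (N + 1)).congr_deriv ?_
        simp
        ring) (Continuous.intervalIntegrable (by fun_prop) _ _)
    rw [this]
    simp
  have hfin : ‖legendreSol l m₀‖ ≤ 1 + ρ * ((1 + y) ^ (N + 1) - 1) := by
    rw [legendreSol_eq_one_add l (raySector_subset hc hm₀s)]
    refine (norm_add_le _ _).trans ?_
    rw [norm_one, norm_mul]
    have h1 := norm_rayMean_le (Continuous.intervalIntegrable (by fun_prop) 0 1) hd
    have h2 := mul_le_mul_of_nonneg_left h1 hy0
    rw [← hint, ← intervalIntegral.integral_const_mul]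
    rw [← intervalIntegral.integral_const_mul] at h2
    refine add_le_add le_rfl (h2.trans (le_of_eq ?_))
    congr 1
    funext s
    ring
  have hρ1 : ρ ≤ 1 := by
    have : ‖legendreSol l m₀‖ = ρ * (1 + y) ^ (N + 1) := by
      rw [hρ, ← hy, div_mul_cancel₀]
      positivity
    rw [this] at hfin
    linarith
  have := hmax (a := 1) (by simp)
  simp only [mem_ofPred_eq, Complex.ofReal_one, mul_one, one_mul] at this
  rw [div_le_iff₀ (by positivity)] at this
  exact this.trans (mul_le_of_le_one_left (by positivity) hρ1)

theorem norm_deriv_legendreSol_le {l : ℂ} {c : ℝ} (hc : 0 < c) {N : ℕ} (hN : ‖l‖ / c ≤ N + 1)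
    {m : ℂ} (hm : m ∈ raySector c) :
    ‖deriv (legendreSol l) m‖ ≤ (N + 1) * (1 + ‖m‖) ^ (N + 1) := by
  rw [deriv_legendreSol (raySector_subset hc hm), norm_div, norm_mul]
  have h1 : ‖rayMean (legendreSol l) m‖ ≤ (1 + ‖m‖) ^ (N + 1) := by
    refine norm_rayMean_le_const fun s hs =>
      (norm_legendreSol_le hc hN (mul_ofReal_mem_raySector hm hs)).trans ?_
    rw [norm_mul, Complex.norm_real, Real.norm_of_nonneg hs.1]
    have hs0 : 0 ≤ s := hs.1
    have : ‖m‖ * s ≤ ‖m‖ := mul_le_of_le_one_right (norm_nonneg m) hs.2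
    gcongr
  have h2 : c ≤ ‖1 + m‖ := by
    refine le_trans ?_ (le_norm_one_add_of_mem_raySector hm)
    nlinarith [norm_nonneg m]
  calc ‖l‖ * ‖rayMean (legendreSol l) m‖ / ‖1 + m‖ ≤ ‖l‖ * (1 + ‖m‖) ^ (N + 1) / c := by gcongr
    _ = ‖l‖ / c * (1 + ‖m‖) ^ (N + 1) := by ring
    _ ≤ _ := by gcongr

/-! ### From the Legendre function to `₂F₁(a, a; 1; ·)` -/

/-- Uniqueness of the analytic solution at `0` of the hypergeometric equation with parameters
`(a, a; 1)`. -/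
theorem eventuallyEq_ordinaryHypergeometric {a : ℂ} {f : ℂ → ℂ} (hf : AnalyticAt ℂ f 0)
    (h0 : f 0 = 1)
    (hode : ∀ᶠ z in 𝓝 0,
      z * (1 - z) * deriv (deriv f) z + (1 - (2 * a + 1) * z) * deriv f z - a ^ 2 * f z = 0) :
    ∀ᶠ z in 𝓝 0, f z = ordinaryHypergeometric a a (1 : ℂ) z := by
  -- The equation differentiated `n` times; at `z = 0` it reduces to the two-term recursion of the
  -- hypergeometric coefficients.
  have hder : ∀ n : ℕ, ∀ᶠ z in 𝓝 (0 : ℂ), z * (1 - z) * iteratedDeriv (n + 2) f z +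
      (n + 1 - (2 * a + 1 + 2 * n) * z) * iteratedDeriv (n + 1) f z -
        (n + a) ^ 2 * iteratedDeriv n f z = 0 := by
    intro n
    induction n with
    | zero =>
      filter_upwards [hode] with z hz
      simpa [iteratedDeriv_succ, iteratedDeriv_zero] using hz
    | succ n ih =>
      filter_upwards [ih.eventually_nhds, hf.eventually_analyticAt] with z hz haz
      have hd : ∀ k, HasDerivAt (iteratedDeriv k f) (iteratedDeriv (k + 1) f z) z := by
        intro k
        rw [iteratedDeriv_succ]
        have : AnalyticAt ℂ (iteratedDeriv k f) z := by
          rw [iteratedDeriv_eq_iterate]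
          exact haz.iterated_deriv k
        exact this.differentiableAt.hasDerivAt
      have h1 := ((((hasDerivAt_id z).mul ((hasDerivAt_id z).const_sub 1)).mul (hd (n + 2))).add
        ((((hasDerivAt_id z).const_mul (2 * a + 1 + 2 * n)).const_sub ((n : ℂ) + 1)).mul
          (hd (n + 1)))).sub ((hd n).const_mul ((n + a) ^ 2))
      have h2 := h1.congr_of_eventuallyEq (f₁ := fun _ => (0 : ℂ)) (by
        filter_upwards [hz] with w hw
        exact hw.symm)
      have h3 := h2.unique (hasDerivAt_const z 0)
      simp only [id, Pi.mul_apply] at h3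
      push_cast
      linear_combination h3
  have hrec : ∀ n : ℕ, (n + 1 : ℂ) * iteratedDeriv (n + 1) f 0 =
      (n + a) ^ 2 * iteratedDeriv n f 0 := by
    intro n
    have := (hder n).self_of_nhds
    simp only [zero_mul, mul_zero, sub_zero, zero_add] at this
    linear_combination this
  have hcoeff : ∀ n : ℕ, iteratedDeriv n f 0 / n.factorial =
      ordinaryHypergeometricCoefficient a a (1 : ℂ) n := by
    intro n
    induction n with
    | zero => simp [ordinaryHypergeometricCoefficient, h0]
    | succ n ih =>
      have hn : (n : ℂ) + 1 ≠ 0 := Nat.cast_add_one_ne_zero n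
      have hfac : (n.factorial : ℂ) ≠ 0 := by exact_mod_cast n.factorial_ne_zero
      have h1 : iteratedDeriv (n + 1) f 0 = (n + a) ^ 2 * iteratedDeriv n f 0 / (n + 1) := by
        rw [eq_div_iff hn, ← hrec n]
        ring
      rw [h1]
      rw [ordinaryHypergeometricCoefficient, ascPochhammer_eval_one] at ih ⊢
      rw [div_eq_iff hfac] at ih
      rw [ascPochhammer_succ_eval, ih, Nat.factorial_succ]
      push_cast
      field_simp
      ring
  obtain ⟨r, hr⟩ := hf.hasFPowerSeriesAt
  filter_upwards [Metric.eball_mem_nhds (0 : ℂ) hr.r_pos] with z hz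
  have := hr.sum hz
  rw [zero_add] at this
  rw [this, ordinaryHypergeometric, ordinaryHypergeometricSeries]
  congr 2
  funext n
  exact hcoeff n

/-- The plane cut along `[1, ∞)`. -/
def rightCutPlane : Set ℂ := {z | 1 - z ∈ Complex.slitPlane}

theorem isOpen_rightCutPlane : IsOpen rightCutPlane :=
  Complex.isOpen_slitPlane.preimage (by fun_prop)

theorem starConvex_rightCutPlane : StarConvex ℝ 0 rightCutPlane := by
  refine starConvex_zero_iff.2 fun m hm s h0 h1 => ?_
  have hm' : 1 + -m ∈ Complex.slitPlane := by
    rw [← sub_eq_add_neg]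
    exact hm
  have := Complex.starConvex_one_slitPlane.add_smul_sub_mem hm' h0 h1
  rw [add_sub_cancel_left, smul_neg, ← sub_eq_add_neg] at this
  exact this

theorem inv_mem_slitPlane {z : ℂ} (hz : z ∈ Complex.slitPlane) : z⁻¹ ∈ Complex.slitPlane := by
  have h0 := Complex.normSq_pos.2 (Complex.slitPlane_ne_zero hz)
  rw [Complex.mem_slitPlane_iff] at hz ⊢
  rw [Complex.inv_re, Complex.inv_im]
  rcases hz with h | h
  · exact Or.inl (div_pos h h0)
  · exact Or.inr (div_ne_zero (neg_ne_zero.2 h) h0.ne')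

theorem one_add_div_one_sub {z : ℂ} (h : 1 - z ≠ 0) : 1 + z / (1 - z) = (1 - z)⁻¹ := by
  field_simp
  ring

theorem div_one_sub_mem_cutPlane {z : ℂ} (hz : z ∈ rightCutPlane) : z / (1 - z) ∈ cutPlane := by
  change 1 + z / (1 - z) ∈ Complex.slitPlane
  rw [one_add_div_one_sub (Complex.slitPlane_ne_zero hz)]
  exact inv_mem_slitPlane hz

/-- The Legendre function, transformed into a solution of the hypergeometric equation with
parameters `(a, a; 1)`. -/
noncomputable def legendreHyp (a z : ℂ) : ℂ :=
  (1 - z) ^ (-a) * legendreSol (a * (a - 1)) (z / (1 - z))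

theorem hasDerivAt_one_sub_cpow (a : ℂ) {z : ℂ} (hz : z ∈ rightCutPlane) :
    HasDerivAt (fun z : ℂ => (1 - z) ^ (-a)) (a * (1 - z) ^ (-a) / (1 - z)) z := by
  have h := ((hasDerivAt_id z).const_sub 1).cpow_const (c := -a) hz
  refine h.congr_deriv ?_
  simp only [id]
  rw [Complex.cpow_sub _ _ (Complex.slitPlane_ne_zero hz), Complex.cpow_one]
  ring

theorem hasDerivAt_div_one_sub {z : ℂ} (hz : 1 - z ≠ 0) :
    HasDerivAt (fun z : ℂ => z / (1 - z)) (1 / (1 - z) ^ 2) z := by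
  refine ((hasDerivAt_id z).div ((hasDerivAt_id z).const_sub 1) hz).congr_deriv ?_
  simp only [id]
  ring

theorem hasDerivAt_legendreHyp (a : ℂ) {z : ℂ} (hz : z ∈ rightCutPlane) :
    HasDerivAt (legendreHyp a) ((1 - z) ^ (-a) * (a / (1 - z) *
      legendreSol (a * (a - 1)) (z / (1 - z)) +
        deriv (legendreSol (a * (a - 1))) (z / (1 - z)) / (1 - z) ^ 2)) z := by
  have h0 : 1 - z ≠ 0 := Complex.slitPlane_ne_zero hz
  have hp := ((differentiableOn_legendreSol (a * (a - 1))).differentiableAt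
    (isOpen_cutPlane.mem_nhds (div_one_sub_mem_cutPlane hz))).hasDerivAt
  have h := (hasDerivAt_one_sub_cpow a hz).mul (hp.comp z (hasDerivAt_div_one_sub h0))
  refine h.congr_deriv ?_
  simp only [Function.comp_apply]
  ring

theorem hasDerivAt_deriv_legendreHyp (a : ℂ) {z : ℂ} (hz : z ∈ rightCutPlane) :
    HasDerivAt (deriv (legendreHyp a)) ((1 - z) ^ (-a) * (a * (a + 1) / (1 - z) ^ 2 *
      legendreSol (a * (a - 1)) (z / (1 - z)) +
      (2 * a + 2) / (1 - z) ^ 3 * deriv (legendreSol (a * (a - 1))) (z / (1 - z)) +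
      deriv (deriv (legendreSol (a * (a - 1)))) (z / (1 - z)) / (1 - z) ^ 4)) z := by
  have h0 : 1 - z ≠ 0 := Complex.slitPlane_ne_zero hz
  have hm := div_one_sub_mem_cutPlane hz
  have hp := ((differentiableOn_legendreSol (a * (a - 1))).differentiableAt
    (isOpen_cutPlane.mem_nhds hm)).hasDerivAt
  have hp2 := hasDerivAt_deriv_legendreSol (a * (a - 1)) hm
  have hd := hasDerivAt_div_one_sub h0
  have hs := (hasDerivAt_id z).const_sub 1
  have h := (hasDerivAt_one_sub_cpow a hz).mul
    ((((hasDerivAt_const z a).div hs h0).mul (hp.comp z hd)).add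
      ((hp2.comp z hd).div (hs.pow 2) (pow_ne_zero 2 h0)))
  refine (h.congr_of_eventuallyEq ?_).congr_deriv ?_
  · filter_upwards [isOpen_rightCutPlane.mem_nhds hz] with w hw
    exact (hasDerivAt_legendreHyp a hw).deriv
  simp only [Function.comp_apply, Pi.mul_apply, Pi.add_apply, Pi.div_apply, Pi.pow_apply, id]
  field_simp
  ring

theorem legendreHyp_ode (a : ℂ) {z : ℂ} (hz : z ∈ rightCutPlane) :
    z * (1 - z) * deriv (deriv (legendreHyp a)) z +
      (1 - (2 * a + 1) * z) * deriv (legendreHyp a) z - a ^ 2 * legendreHyp a z = 0 := by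
  have h0 : 1 - z ≠ 0 := Complex.slitPlane_ne_zero hz
  rw [(hasDerivAt_deriv_legendreHyp a hz).deriv, (hasDerivAt_legendreHyp a hz).deriv, legendreHyp]
  have h := legendreSol_ode (a * (a - 1)) (div_one_sub_mem_cutPlane hz)
  generalize deriv (deriv (legendreSol (a * (a - 1)))) (z / (1 - z)) = p2 at *
  generalize deriv (legendreSol (a * (a - 1))) (z / (1 - z)) = p1 at *
  generalize legendreSol (a * (a - 1)) (z / (1 - z)) = p0 at *
  generalize (1 - z) ^ (-a) = E
  field_simp at h ⊢
  linear_combination E * h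

/-- The map `z ↦ z / (1 - z)` sends the plane cut along `[1, ∞)` into the plane cut along `(-∞,
-1]`, so the transformed Legendre function is the principal branch on its whole domain, including
`|z| > 1`. -/
theorem isHypBranch_legendreHyp (a : ℂ) :
    IsHypBranch a a 1 rightCutPlane (legendreHyp a) := by
  have h0 : (0 : ℂ) ∈ rightCutPlane := by simp [rightCutPlane]
  have hd : DifferentiableOn ℂ (legendreHyp a) rightCutPlane := fun z hz =>
    (hasDerivAt_legendreHyp a hz).differentiableAt.differentiableWithinAt
  refine ⟨isOpen_rightCutPlane, h0, starConvex_rightCutPlane, hd,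
    eventuallyEq_ordinaryHypergeometric (hd.analyticAt (isOpen_rightCutPlane.mem_nhds h0)) ?_ ?_⟩
  · simp [legendreHyp, legendreSol_zero]
  · filter_upwards [isOpen_rightCutPlane.mem_nhds h0] with z hz using legendreHyp_ode a hz

theorem hyp2F1_eq_legendreHyp (a : ℂ) {z : ℂ} (hz : z ∈ rightCutPlane) :
    hyp2F1 a a 1 z = legendreHyp a z :=
  hyp2F1_eq (isHypBranch_legendreHyp a) hz

/-! ### The quadratic curve avoids the cut -/

/-- The shifted product `(1 + γ u) (1 + β u) - 1`. -/
noncomputable def shiftedProd (γ β : ℂ) (u : ℝ) : ℂ := (1 + γ * u) * (1 + β * u) - 1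

theorem shiftedProd_comm (γ β : ℂ) (u : ℝ) : shiftedProd γ β u = shiftedProd β γ u := by
  simp only [shiftedProd, mul_comm]

theorem one_add_norm_shiftedProd_le {C : ℝ} {γ β : ℂ} (hγ : ‖γ‖ ≤ C) (hβ : ‖β‖ ≤ C) {u : ℝ}
    (hu : 0 ≤ u) : 1 + ‖shiftedProd γ β u‖ ≤ (1 + C * u) ^ 2 := by
  have e : shiftedProd γ β u = γ * u + β * u + γ * β * (u * u) := by
    rw [shiftedProd]
    ring
  have hC : 0 ≤ C := (norm_nonneg γ).trans hγ
  have h : ‖shiftedProd γ β u‖ ≤ ‖γ‖ * u + ‖β‖ * u + ‖γ‖ * ‖β‖ * (u * u) := by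
    rw [e]
    refine (norm_add₃_le).trans (le_of_eq ?_)
    simp only [norm_mul, Complex.norm_real, Real.norm_of_nonneg hu]
  have h2 : ‖γ‖ * u + ‖β‖ * u + ‖γ‖ * ‖β‖ * (u * u) ≤ C * u + C * u + C * C * (u * u) := by
    gcongr
  linarith [h.trans h2]

theorem norm_add_mul_ofReal_le_re {c : ℝ} {a b : ℂ} (ha : c * ‖a‖ ≤ a.re) (hb : c * ‖b‖ ≤ b.re)
    (hc : 0 ≤ c) {u : ℝ} (hu : 0 ≤ u) : c * ‖a + b * u‖ ≤ (a + b * u).re := by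
  have h1 : ‖a + b * u‖ ≤ ‖a‖ + ‖b‖ * u := by
    refine (norm_add_le _ _).trans (le_of_eq ?_)
    rw [norm_mul, Complex.norm_real, Real.norm_of_nonneg hu]
  have h2 : (a + b * u).re = a.re + b.re * u := by simp
  rw [h2]
  nlinarith [mul_le_mul_of_nonneg_left h1 hc, mul_le_mul_of_nonneg_right hb hu]

theorem inv_re_eq (z : ℂ) : (z⁻¹).re = z.re / ‖z‖ ^ 2 := by
  rw [Complex.inv_re, Complex.normSq_eq_norm_sq]

/-- The product factors as `A B` with `A = s⁻¹ + (γ/s) u` and `B = s + β s u`, both in a closed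
sector strictly inside the right half-plane. Then `1 + τ (A B - 1) = A ((1 - τ) A⁻¹ + τ B)`, and the
bracket is a convex combination of points of that sector, hence no cancellation. -/
theorem shiftedProd_mem_raySector {c : ℝ} (hc : 0 < c) {s γ β : ℂ} (hs0 : s ≠ 0)
    (hs : c * ‖s‖ ≤ s.re) (hγ : c * ‖γ / s‖ ≤ (γ / s).re) (hβ : c * ‖β * s‖ ≤ (β * s).re) {u : ℝ}
    (hu : 0 ≤ u) : shiftedProd γ β u ∈ raySector (c ^ 3 / (c ^ 2 + 2)) := by
  have hsn : 0 < ‖s‖ := norm_pos_iff.2 hs0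
  have hs' : c * ‖s⁻¹‖ ≤ (s⁻¹).re := by
    rw [inv_re_eq, norm_inv, le_div_iff₀ (by positivity)]
    calc c * ‖s‖⁻¹ * ‖s‖ ^ 2 = c * ‖s‖ := by field_simp
      _ ≤ _ := hs
  set A := s⁻¹ + γ / s * u with hA
  set B := s + β * s * u with hB
  have hA1 : c * ‖A‖ ≤ A.re := norm_add_mul_ofReal_le_re hs' hγ hc.le hu
  have hB1 : c * ‖B‖ ≤ B.re := norm_add_mul_ofReal_le_re hs hβ hc.le hu
  have hAB : A * B = (1 + γ * u) * (1 + β * u) := by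
    rw [hA, hB]
    field_simp
  have hA2 : c * ‖s‖⁻¹ ≤ ‖A‖ := by
    refine le_trans ?_ (Complex.re_le_norm A)
    have : A.re = (s⁻¹).re + (γ / s).re * u := by simp [hA]
    rw [this, ← norm_inv]
    have h1 : 0 ≤ (γ / s).re := le_trans (by positivity) hγ
    nlinarith [mul_nonneg h1 hu]
  have hB2 : c * ‖s‖ ≤ ‖B‖ := by
    refine le_trans ?_ (Complex.re_le_norm B)
    have : B.re = s.re + (β * s).re * u := by simp [hB]
    rw [this]
    have h1 : 0 ≤ (β * s).re := le_trans (by positivity) hβ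
    nlinarith [mul_nonneg h1 hu]
  have hA0 : 0 < ‖A‖ := lt_of_lt_of_le (by positivity) hA2
  have hX : c ^ 2 ≤ ‖A‖ * ‖B‖ := by
    calc c ^ 2 = (c * ‖s‖⁻¹) * (c * ‖s‖) := by field_simp
      _ ≤ _ := by gcongr
  intro τ hτ
  have hτ0 : 0 ≤ τ := hτ.1
  have hm : ‖shiftedProd γ β u‖ ≤ ‖A‖ * ‖B‖ + 1 := by
    rw [shiftedProd, ← hAB, ← norm_mul]
    exact (norm_sub_le _ _).trans (by simp)
  have e : 1 + (τ : ℂ) * shiftedProd γ β u = A * (A⁻¹ * ((1 - τ : ℝ) : ℂ) + B * (τ : ℂ)) := by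
    rw [shiftedProd, ← hAB]
    have : A ≠ 0 := norm_pos_iff.1 hA0
    field_simp
    push_cast
    ring
  have hlow : c * ((1 - τ) + τ * (‖A‖ * ‖B‖)) ≤ ‖1 + (τ : ℂ) * shiftedProd γ β u‖ := by
    rw [e, norm_mul]
    have h1 : A.re / ‖A‖ ^ 2 * (1 - τ) + B.re * τ ≤ ‖A⁻¹ * ((1 - τ : ℝ) : ℂ) + B * (τ : ℂ)‖ := by
      refine le_trans (le_of_eq ?_) (Complex.re_le_norm _)
      rw [Complex.add_re (A⁻¹ * _), Complex.re_mul_ofReal, Complex.re_mul_ofReal, inv_re_eq]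
    have h2 : c * ‖A‖ / ‖A‖ ^ 2 * (1 - τ) + c * ‖B‖ * τ ≤
        A.re / ‖A‖ ^ 2 * (1 - τ) + B.re * τ := by
      have : 0 ≤ 1 - τ := by linarith [hτ.2]
      gcongr
    calc c * ((1 - τ) + τ * (‖A‖ * ‖B‖))
        = ‖A‖ * (c * ‖A‖ / ‖A‖ ^ 2 * (1 - τ) + c * ‖B‖ * τ) := by
          field_simp
      _ ≤ _ := by gcongr; exact h2.trans h1
  refine le_trans ?_ hlow
  rw [div_mul_eq_mul_div, div_le_iff₀ (by positivity)]
  have h3 : c ^ 3 * (1 + τ * ‖shiftedProd γ β u‖) ≤ c ^ 3 * (1 + τ * (‖A‖ * ‖B‖ + 1)) := by gcongr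
  refine h3.trans ?_
  -- With `X` the right-hand side, `1 + τ (‖A‖ ‖B‖ + 1) = X + 2 τ`, so `c² (X + 2 τ) ≤ (c² + 2) X`;
  -- this is where the constant comes from.
  have h4 : c ^ 2 * τ ≤ (1 - τ) + τ * (‖A‖ * ‖B‖) := by
    nlinarith [mul_le_mul_of_nonneg_left hX hτ0, hτ.2]
  nlinarith [mul_le_mul_of_nonneg_left h4 hc.le]

/-- A condition on `γ` and `β` which ensures that the curve `u ↦ (1 + γ u) (1 + β u)`, `u ≥ 0`,
avoids `(-∞, 0]`, locally uniformly in `γ`. -/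
def CompatibleSlopes (γ β : ℂ) : Prop :=
  ∃ s : ℂ, 0 < s.re ∧ 0 < (γ / s).re ∧ (β = 0 ∨ 0 < (β * s).re)

theorem CompatibleSlopes.exists_ball {γ₀ β : ℂ} (h : CompatibleSlopes γ₀ β) :
    ∃ ε > 0, ∃ c > 0, ∀ γ ∈ Metric.ball γ₀ ε, ∀ u : ℝ, 0 ≤ u →
      shiftedProd γ β u ∈ raySector c := by
  obtain ⟨s, hs, hγ, hβ⟩ := h
  have pos : ∀ z : ℂ, 0 < z.re → 0 < ‖z‖ := fun z hz => hz.trans_le (Complex.re_le_norm z)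
  have hs0 : s ≠ 0 := norm_pos_iff.1 (pos s hs)
  obtain ⟨c₂, hc₂, h₂⟩ : ∃ c > 0, c * ‖β * s‖ ≤ (β * s).re := by
    rcases hβ with rfl | hβ
    · exact ⟨1, one_pos, by simp⟩
    · have := pos _ hβ
      exact ⟨(β * s).re / ‖β * s‖, by positivity, by rw [div_mul_cancel₀ _ this.ne']⟩
  have hsn := pos s hs
  have hγn := pos _ hγ
  -- Half of the sharp constant at `γ₀`: the strict inequality survives for nearby `γ`.
  set c₃ := (γ₀ / s).re / (2 * ‖γ₀ / s‖) with hc₃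
  have hc₃0 : 0 < c₃ := by positivity
  have hcont : Continuous fun γ : ℂ => (γ / s).re - c₃ * ‖γ / s‖ := by fun_prop
  have hev : ∀ᶠ γ in 𝓝 γ₀, 0 < (γ / s).re - c₃ * ‖γ / s‖ := by
    refine hcont.continuousAt.eventually (lt_mem_nhds ?_)
    have : c₃ * ‖γ₀ / s‖ = (γ₀ / s).re / 2 := by
      rw [hc₃]
      field_simp
    change 0 < (γ₀ / s).re - c₃ * ‖γ₀ / s‖
    rw [this]
    linarith
  obtain ⟨ε, hε, hb⟩ := Metric.eventually_nhds_iff_ball.1 hev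
  set c₁ := s.re / ‖s‖ with hc₁
  have hc₁0 : 0 < c₁ := by positivity
  have h₁ : c₁ * ‖s‖ ≤ s.re := by rw [hc₁, div_mul_cancel₀ _ hsn.ne']
  set c := min c₁ (min c₂ c₃) with hc
  have hc0 : 0 < c := by positivity
  have i1 : c ≤ c₁ := min_le_left _ _
  have i2 : c ≤ c₂ := (min_le_right _ _).trans (min_le_left _ _)
  have i3 : c ≤ c₃ := (min_le_right _ _).trans (min_le_right _ _)
  refine ⟨ε, hε, c ^ 3 / (c ^ 2 + 2), by positivity, fun γ hγ' u hu => ?_⟩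
  refine shiftedProd_mem_raySector hc0 hs0 (le_trans ?_ h₁) (le_trans ?_ (sub_pos.1 (hb γ hγ')).le)
    (le_trans ?_ h₂) hu
  all_goals gcongr

/-! ### The Laplace transform of the Legendre function -/

theorem exists_one_add_mul_pow_le_exp (C : ℝ) (k : ℕ) {δ : ℝ} (hδ : 0 < δ) :
    ∃ D : ℝ, 0 ≤ D ∧ ∀ u : ℝ, 0 ≤ u → |1 + C * u| ^ k ≤ D * rexp (δ * u) := by
  set η := δ / (k + 1) with hη
  have hη0 : 0 < η := by positivity
  set E := max 1 (|C| / η) with hE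
  have hE0 : 0 ≤ E := zero_le_one.trans (le_max_left _ _)
  refine ⟨E ^ k, by positivity, fun u hu => ?_⟩
  have h1 : |1 + C * u| ≤ E * rexp (η * u) := by
    have i1 : (1 : ℝ) ≤ E := le_max_left _ _
    have i2 : |C| ≤ E * η := by
      rw [← div_le_iff₀ hη0]
      exact le_max_right _ _
    calc |1 + C * u| ≤ 1 + |C| * u := by
          refine (abs_add_le _ _).trans (le_of_eq ?_)
          rw [abs_one, abs_mul, abs_of_nonneg hu]
      _ ≤ E + E * η * u := by gcongr
      _ = E * (η * u + 1) := by ring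
      _ ≤ _ := by gcongr; exact Real.add_one_le_exp _
  calc |1 + C * u| ^ k ≤ (E * rexp (η * u)) ^ k := by gcongr
    _ = E ^ k * rexp (k * (η * u)) := by rw [mul_pow, ← Real.exp_nat_mul]
    _ ≤ _ := by
      have h2 : k * η ≤ δ := by
        rw [hη, mul_div_assoc', div_le_iff₀ (by positivity)]
        nlinarith
      have h3 : k * (η * u) ≤ δ * u := by
        rw [← mul_assoc]
        gcongr
      gcongr

/-- Any rate below `1/2` would do: against `e^{-u}`, the later boundary term spends the rate twice,
once for `p'` and once for its polynomial factor. The power `2 (N + 1)` reflects that the curve is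
quadratic in `u`. -/
theorem exists_norm_legendreSol_shiftedProd_le (l : ℂ) {c : ℝ} (hc : 0 < c) (C : ℝ) :
    ∃ D : ℝ, 0 ≤ D ∧ ∀ γ β : ℂ, ‖γ‖ ≤ C → ‖β‖ ≤ C → ∀ u : ℝ, 0 ≤ u →
      shiftedProd γ β u ∈ raySector c →
        ‖legendreSol l (shiftedProd γ β u)‖ ≤ D * rexp (4⁻¹ * u) ∧
        ‖deriv (legendreSol l) (shiftedProd γ β u)‖ ≤ D * rexp (4⁻¹ * u) := by
  obtain ⟨N, hN⟩ := exists_nat_ge (‖l‖ / c)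
  have hN' : ‖l‖ / c ≤ N + 1 := by linarith
  obtain ⟨D, hD0, hD⟩ := exists_one_add_mul_pow_le_exp C (2 * (N + 1)) (δ := 4⁻¹) (by norm_num)
  refine ⟨(N + 1) * D, by positivity, fun γ β hγ hβ u hu hm => ?_⟩
  have h1 : (1 + ‖shiftedProd γ β u‖) ^ (N + 1) ≤ D * rexp (4⁻¹ * u) := by
    refine le_trans ?_ (hD u hu)
    rw [pow_mul, sq_abs]
    exact pow_le_pow_left₀ (by positivity) (one_add_norm_shiftedProd_le hγ hβ hu) _
  constructor
  · refine (norm_legendreSol_le hc hN' hm).trans (h1.trans ?_)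
    rw [mul_assoc]
    refine le_mul_of_one_le_left (by positivity) ?_
    linarith [(Nat.cast_nonneg N : (0 : ℝ) ≤ N)]
  · refine (norm_deriv_legendreSol_le hc hN' hm).trans ?_
    rw [mul_assoc]
    gcongr

/-- The integrand of `legendreLaplace`. -/
noncomputable def legendreKernel (l γ β : ℂ) (u : ℝ) : ℂ :=
  (rexp (-u) : ℂ) * legendreSol l (shiftedProd γ β u)

/-- The Laplace transform at `1` of `u ↦ legendreSol l ((1 + γ u) (1 + β u) - 1)`. -/
noncomputable def legendreLaplace (l γ β : ℂ) : ℂ := ∫ u in Ioi (0 : ℝ), legendreKernel l γ β u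

theorem legendreLaplace_comm (l γ β : ℂ) : legendreLaplace l γ β = legendreLaplace l β γ := by
  simp only [legendreLaplace, legendreKernel, shiftedProd_comm γ β]

theorem norm_legendreKernel_le {l γ β : ℂ} {u D : ℝ}
    (h : ‖legendreSol l (shiftedProd γ β u)‖ ≤ D * rexp (4⁻¹ * u)) :
    ‖legendreKernel l γ β u‖ ≤ D * rexp (-(3 / 4) * u) := by
  rw [legendreKernel, norm_mul, Complex.norm_real, Real.norm_of_nonneg (Real.exp_pos _).le]
  calc rexp (-u) * ‖legendreSol l (shiftedProd γ β u)‖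
      ≤ rexp (-u) * (D * rexp (4⁻¹ * u)) := by gcongr
    _ = D * (rexp (-u) * rexp (4⁻¹ * u)) := by ring
    _ = _ := by
      rw [← Real.exp_add]
      ring_nf

theorem integrableOn_const_mul_exp (D : ℝ) :
    IntegrableOn (fun u : ℝ => D * rexp (-(3 / 4) * u)) (Ioi 0) :=
  (integrableOn_exp_mul_Ioi (by norm_num) 0).const_mul D

theorem continuous_shiftedProd (γ β : ℂ) : Continuous (shiftedProd γ β) := by
  unfold shiftedProd
  fun_prop

theorem continuousOn_legendreKernel {l γ β : ℂ} {S : Set ℝ}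
    (h : ∀ u ∈ S, shiftedProd γ β u ∈ cutPlane) : ContinuousOn (legendreKernel l γ β) S := by
  unfold legendreKernel
  refine ContinuousOn.mul (by fun_prop) ?_
  exact (differentiableOn_legendreSol l).continuousOn.comp (continuous_shiftedProd γ β).continuousOn h

theorem CompatibleSlopes.mem_cutPlane {γ β : ℂ} (h : CompatibleSlopes γ β) {u : ℝ} (hu : 0 ≤ u) :
    shiftedProd γ β u ∈ cutPlane := by
  obtain ⟨ε, hε, c, hc, hb⟩ := h.exists_ball
  exact raySector_subset hc (hb γ (Metric.mem_ball_self hε) u hu)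

theorem locDominated_legendreKernel (l : ℂ) {U : Set ℂ} {β : ℂ}
    (h : ∀ γ ∈ U, CompatibleSlopes γ β) :
    LocDominated (volume.restrict (Ioi (0 : ℝ))) U (fun γ u => legendreKernel l γ β u) where
  diff := by
    filter_upwards [ae_restrict_mem measurableSet_Ioi] with u hu
    unfold legendreKernel
    refine DifferentiableOn.const_mul ?_ _
    refine (differentiableOn_legendreSol l).comp ?_ fun γ hγ => (h γ hγ).mem_cutPlane (le_of_lt hu)
    unfold shiftedProd
    fun_prop
  meas := fun γ hγ => (continuousOn_legendreKernel fun u hu =>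
    (h γ hγ).mem_cutPlane (le_of_lt hu)).aestronglyMeasurable measurableSet_Ioi
  dom := by
    intro γ hγ
    obtain ⟨ε, hε, c, hc, hb⟩ := (h γ hγ).exists_ball
    obtain ⟨D, -, hD⟩ := exists_norm_legendreSol_shiftedProd_le l hc (max (‖γ‖ + ε) ‖β‖)
    refine ⟨ε, hε, _, integrableOn_const_mul_exp D, ?_⟩
    filter_upwards [ae_restrict_mem measurableSet_Ioi] with u hu w hw
    have hu0 : (0 : ℝ) ≤ u := le_of_lt hu
    refine norm_legendreKernel_le (hD w β ?_ (le_max_right _ _) u hu0 (hb w hw u hu0)).1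
    refine le_trans ?_ (le_max_left _ _)
    have h := norm_le_norm_add_norm_sub' w γ
    rw [Metric.mem_ball, dist_eq_norm] at hw
    linarith

/-! ### Admissible pairs of slopes -/

/-- A bisector of the angle between `γ` and the positive half-line. -/
noncomputable def bisector (γ : ℂ) : ℂ := ‖γ‖ + γ

theorem bisector_re_pos {γ : ℂ} (h : γ ∈ Complex.slitPlane) : 0 < (bisector γ).re := by
  rw [bisector, Complex.add_re, Complex.ofReal_re]
  have h1 := Complex.abs_re_le_norm γ
  rw [Complex.mem_slitPlane_iff] at h
  rcases h with h | h
  · linarith [norm_nonneg γ]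
  · have := Complex.abs_re_lt_norm.2 h
    linarith [neg_abs_le γ.re]

theorem mul_conj_bisector (γ : ℂ) : γ * starRingEnd ℂ (bisector γ) = ‖γ‖ * bisector γ := by
  rw [bisector, map_add, Complex.conj_ofReal, mul_add, Complex.mul_conj, Complex.normSq_eq_norm_sq]
  push_cast
  ring

theorem conj_mul_bisector (γ : ℂ) :
    starRingEnd ℂ γ * bisector γ = ‖γ‖ * starRingEnd ℂ (bisector γ) := by
  have := congrArg (starRingEnd ℂ) (mul_conj_bisector γ)
  simpa using this

/-- The bisector has half the argument of `γ`, so the quotient is a positive multiple of the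
bisector itself. -/
theorem div_bisector_re_pos {γ : ℂ} (h : γ ∈ Complex.slitPlane) : 0 < (γ / bisector γ).re := by
  have h1 := bisector_re_pos h
  have h0 : 0 < Complex.normSq (bisector γ) := by
    refine Complex.normSq_pos.2 fun h0 => ?_
    simp [h0] at h1
  have hγ : 0 < ‖γ‖ := norm_pos_iff.2 (Complex.slitPlane_ne_zero h)
  have e : γ / bisector γ = ((‖γ‖ / Complex.normSq (bisector γ) : ℝ) : ℂ) * bisector γ := by
    rw [div_eq_mul_inv, Complex.inv_def, ← mul_assoc, mul_conj_bisector]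
    push_cast
    ring
  rw [e, Complex.re_ofReal_mul]
  positivity

theorem compatibleSlopes_ofReal {γ : ℂ} (h : γ ∈ Complex.slitPlane) {b : ℝ} (hb : 0 ≤ b) :
    CompatibleSlopes γ b := by
  refine ⟨bisector γ, bisector_re_pos h, div_bisector_re_pos h, ?_⟩
  rcases hb.eq_or_lt with rfl | hb
  · simp
  · right
    rw [Complex.re_ofReal_mul]
    exact mul_pos hb (bisector_re_pos h)

/-- Here `β` is the moving slope, so it takes the first slot and the auxiliary direction is the
inverse of the bisector. -/
theorem compatibleSlopes_of_re_pos {γ β : ℂ} (h : γ ∈ Complex.slitPlane)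
    (hβ : 0 < (β * bisector γ).re) : CompatibleSlopes β γ := by
  have h1 := bisector_re_pos h
  refine ⟨(bisector γ)⁻¹, ?_, by simpa using hβ, Or.inr (div_bisector_re_pos h)⟩
  rw [inv_re_eq]
  have : 0 < ‖bisector γ‖ := h1.trans_le (Complex.re_le_norm _)
  positivity

/-! ### The differential equation of the Laplace transform -/

theorem LocDominated.comp {α : Type*} [MeasurableSpace α] {μ : Measure α} {U V : Set ℂ}
    {F : ℂ → α → ℂ} (h : LocDominated μ U F) {φ : ℂ → ℂ} (hV : IsOpen V)
    (hφ : DifferentiableOn ℂ φ V) (hm : MapsTo φ V U) : LocDominated μ V (fun z => F (φ z)) where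
  diff := by
    filter_upwards [h.diff] with u hu using hu.comp hφ hm
  meas := fun z hz => h.meas _ (hm hz)
  dom := by
    intro z hz
    obtain ⟨ε, hε, g, hg, hb⟩ := h.dom _ (hm hz)
    obtain ⟨δ, hδ, hball⟩ := Metric.eventually_nhds_iff_ball.1
      ((hφ.differentiableAt (hV.mem_nhds hz)).continuousAt.eventually (Metric.ball_mem_nhds _ hε))
    refine ⟨δ, hδ, g, hg, ?_⟩
    filter_upwards [hb] with u hu w hw using hu _ (hball w hw)

theorem inv_two_mul_mem_slitPlane {a : ℂ} (ha : a ∈ Complex.slitPlane) :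
    (2 * a)⁻¹ ∈ Complex.slitPlane := by
  refine inv_mem_slitPlane ?_
  rw [Complex.mem_slitPlane_iff] at ha ⊢
  simpa using ha

theorem hasDerivAt_inv_two_mul {a : ℂ} (ha : a ≠ 0) :
    HasDerivAt (fun a : ℂ => (2 * a)⁻¹) (-(1 / (2 * a ^ 2))) a := by
  refine (((hasDerivAt_id a).const_mul 2).inv (by simpa using ha)).congr_deriv ?_
  simp only [id]
  field_simp

theorem locDominated_legendreKernel_inv (l : ℂ) {b : ℝ} (hb : 0 ≤ b) :
    LocDominated (volume.restrict (Ioi (0 : ℝ))) Complex.slitPlane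
      (fun a u => legendreKernel l (2 * a)⁻¹ b u) :=
  (locDominated_legendreKernel l fun _ h => compatibleSlopes_ofReal h hb).comp
    Complex.isOpen_slitPlane (fun _ ha => (hasDerivAt_inv_two_mul
      (Complex.slitPlane_ne_zero ha)).differentiableAt.differentiableWithinAt)
    (fun _ ha => inv_two_mul_mem_slitPlane ha)

theorem hasDerivAt_shiftedProd_inv (b u : ℝ) {a : ℂ} (ha : a ≠ 0) :
    HasDerivAt (fun a : ℂ => shiftedProd (2 * a)⁻¹ b u) (-(u * (1 + b * u) / (2 * a ^ 2))) a := by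
  unfold shiftedProd
  refine (((((hasDerivAt_inv_two_mul ha).mul_const (u : ℂ)).const_add 1).mul_const
    (1 + (b : ℂ) * u)).sub_const 1).congr_deriv ?_
  ring

theorem shiftedProd_inv_mem_cutPlane {b u : ℝ} (hb : 0 ≤ b) (hu : 0 ≤ u) {a : ℂ}
    (ha : a ∈ Complex.slitPlane) : shiftedProd (2 * a)⁻¹ b u ∈ cutPlane :=
  (compatibleSlopes_ofReal (inv_two_mul_mem_slitPlane ha) hb).mem_cutPlane hu

theorem hasDerivAt_legendreKernel_inv (l : ℂ) {b u : ℝ} (hb : 0 ≤ b) (hu : 0 ≤ u) {a : ℂ}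
    (ha : a ∈ Complex.slitPlane) :
    HasDerivAt (fun a : ℂ => legendreKernel l (2 * a)⁻¹ b u)
      ((rexp (-u) : ℂ) * (deriv (legendreSol l) (shiftedProd (2 * a)⁻¹ b u) *
        -(u * (1 + b * u) / (2 * a ^ 2)))) a := by
  unfold legendreKernel
  have hp := ((differentiableOn_legendreSol l).differentiableAt
    (isOpen_cutPlane.mem_nhds (shiftedProd_inv_mem_cutPlane hb hu ha))).hasDerivAt
  exact (hp.comp a (hasDerivAt_shiftedProd_inv b u (Complex.slitPlane_ne_zero ha))).const_mul _

theorem hasDerivAt_deriv_legendreKernel_inv (l : ℂ) {b u : ℝ} (hb : 0 ≤ b) (hu : 0 ≤ u) {a : ℂ}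
    (ha : a ∈ Complex.slitPlane) :
    HasDerivAt (deriv fun a : ℂ => legendreKernel l (2 * a)⁻¹ b u)
      ((rexp (-u) : ℂ) * (deriv (deriv (legendreSol l)) (shiftedProd (2 * a)⁻¹ b u) *
        (u * (1 + b * u) / (2 * a ^ 2)) ^ 2 +
          deriv (legendreSol l) (shiftedProd (2 * a)⁻¹ b u) * (u * (1 + b * u) / a ^ 3))) a := by
  have a0 := Complex.slitPlane_ne_zero ha
  have hp := hasDerivAt_deriv_legendreSol l (shiftedProd_inv_mem_cutPlane hb hu ha)
  have h1 : HasDerivAt (fun a : ℂ => -((u : ℂ) * (1 + b * u) / (2 * a ^ 2)))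
      (u * (1 + b * u) / a ^ 3) a := by
    refine ((hasDerivAt_const a ((u : ℂ) * (1 + b * u))).div
      (((hasDerivAt_id a).pow 2).const_mul 2) (by simpa using a0)).neg.congr_deriv ?_
    simp only [Pi.pow_apply, id]
    field_simp
    ring
  refine (HasDerivAt.congr_of_eventuallyEq
    (((hp.comp a (hasDerivAt_shiftedProd_inv b u a0)).mul h1).const_mul (rexp (-u) : ℂ))
      ?_).congr_deriv ?_
  · filter_upwards [Complex.isOpen_slitPlane.mem_nhds ha] with w hw
    exact (hasDerivAt_legendreKernel_inv l hb hu hw).deriv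
  · simp only [Function.comp_apply]
    ring

/-- Along the half-line `u ≥ 0`, the differential operator in `a` that annihilates the Laplace
transform produces an exact derivative in `u`. -/
theorem hasDerivAt_legendreKernel_boundary (l : ℂ) {b u : ℝ} (hb : 0 ≤ b) (hu : 0 ≤ u) {a : ℂ}
    (ha : a ∈ Complex.slitPlane) :
    HasDerivAt (fun u : ℝ => -((rexp (-u) : ℂ) * (u * (1 + b * u)) *
        deriv (legendreSol l) (shiftedProd (2 * a)⁻¹ b u)))
      (a ^ 2 * (deriv (deriv fun a : ℂ => legendreKernel l (2 * a)⁻¹ b u) a -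
        2 * deriv (fun a : ℂ => legendreKernel l (2 * a)⁻¹ b u) a) -
          l * legendreKernel l (2 * a)⁻¹ b u) u := by
  have a0 := Complex.slitPlane_ne_zero ha
  have hm := shiftedProd_inv_mem_cutPlane hb hu ha
  have hp : HasDerivAt (deriv (legendreSol l))
      (deriv (deriv (legendreSol l)) ((1 + (2 * a)⁻¹ * (u : ℂ)) * (1 + (b : ℂ) * u) - 1))
      ((1 + (2 * a)⁻¹ * (u : ℂ)) * (1 + (b : ℂ) * u) - 1) := hasDerivAt_deriv_legendreSol l hm
  have hid := hasDerivAt_id (u : ℂ)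
  have hb1 := (hid.const_mul (b : ℂ)).const_add 1
  have hq := (((hid.const_mul (2 * a)⁻¹).const_add 1).mul hb1).sub_const 1
  have hG := (((hid.neg.cexp).mul (hid.mul hb1)).mul (hp.comp (u : ℂ) hq)).neg
  have hG' := hG.comp_ofReal
  refine (hG'.congr_of_eventuallyEq (Eventually.of_forall fun v => ?_)).congr_deriv ?_
  · rw [Complex.ofReal_exp, Complex.ofReal_neg, shiftedProd]
    rfl
  rw [(hasDerivAt_deriv_legendreKernel_inv l hb hu ha).deriv,
    (hasDerivAt_legendreKernel_inv l hb hu ha).deriv, legendreKernel, Complex.ofReal_exp,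
    Complex.ofReal_neg]
  have h := legendreSol_ode l hm
  simp only [shiftedProd, Pi.mul_apply, Function.comp_apply, id, Pi.neg_apply] at h ⊢
  generalize deriv (deriv (legendreSol l)) ((1 + (2 * a)⁻¹ * (u : ℂ)) * (1 + (b : ℂ) * u) - 1) = p2 at *
  generalize deriv (legendreSol l) ((1 + (2 * a)⁻¹ * (u : ℂ)) * (1 + (b : ℂ) * u) - 1) = p1 at *
  generalize legendreSol l ((1 + (2 * a)⁻¹ * (u : ℂ)) * (1 + (b : ℂ) * u) - 1) = p0 at *
  generalize Complex.exp (-(u : ℂ)) = E at *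
  -- The Legendre equation eliminates `l * p0`; what remains is a rational identity in which `p1`,
  -- `p2` and `E` are free.
  have h' : l * p0 = _ := h.symm
  rw [show ∀ X : ℂ, X - l * (E * p0) = X - E * (l * p0) from fun X => by ring, h']
  field_simp
  ring

theorem CompatibleSlopes.exists_bound (l : ℂ) {γ β : ℂ} (h : CompatibleSlopes γ β) :
    ∃ D : ℝ, 0 ≤ D ∧ ∀ u : ℝ, 0 ≤ u →
      ‖legendreSol l (shiftedProd γ β u)‖ ≤ D * rexp (4⁻¹ * u) ∧
      ‖deriv (legendreSol l) (shiftedProd γ β u)‖ ≤ D * rexp (4⁻¹ * u) := by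
  obtain ⟨ε, hε, c, hc, hb⟩ := h.exists_ball
  obtain ⟨D, hD0, hD⟩ := exists_norm_legendreSol_shiftedProd_le l hc (max ‖γ‖ ‖β‖)
  exact ⟨D, hD0, fun u hu => hD γ β (le_max_left _ _) (le_max_right _ _) u hu
    (hb γ (Metric.mem_ball_self hε) u hu)⟩

theorem tendsto_legendreKernel_boundary (l : ℂ) {b : ℝ} (hb : 0 ≤ b) {a : ℂ}
    (ha : a ∈ Complex.slitPlane) :
    Tendsto (fun u : ℝ => -((rexp (-u) : ℂ) * (u * (1 + b * u)) *
        deriv (legendreSol l) (shiftedProd (2 * a)⁻¹ b u))) atTop (𝓝 0) := by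
  obtain ⟨D, hD0, hD⟩ :=
    (compatibleSlopes_ofReal (inv_two_mul_mem_slitPlane ha) hb).exists_bound l
  obtain ⟨E, hE0, hE⟩ := exists_one_add_mul_pow_le_exp (1 + b) 2 (δ := 4⁻¹) (by norm_num)
  have ht : Tendsto (fun u : ℝ => D * E * rexp (-(2⁻¹ * u))) atTop (𝓝 0) := by
    have h1 : Tendsto (fun u : ℝ => (2⁻¹ : ℝ) * u) atTop atTop :=
      tendsto_id.const_mul_atTop (by norm_num)
    simpa [Function.comp_def] using ((Real.tendsto_exp_neg_atTop_nhds_zero.comp h1).const_mul (D * E))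
  refine squeeze_zero_norm' ?_ ht
  filter_upwards [eventually_ge_atTop 0] with u hu
  have h1 : ‖(u : ℂ) * (1 + b * u)‖ ≤ E * rexp (4⁻¹ * u) := by
    refine le_trans ?_ (hE u hu)
    rw [sq_abs]
    have e : (u : ℂ) * (1 + b * u) = ((u * (1 + b * u) : ℝ) : ℂ) := by push_cast; ring
    rw [e, Complex.norm_real, Real.norm_of_nonneg (by positivity)]
    nlinarith [mul_nonneg hb hu, mul_nonneg hu hu, mul_nonneg (mul_nonneg hb hu) hu,
      mul_nonneg (mul_nonneg hb hu) (mul_nonneg hb hu)]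
  rw [norm_neg, norm_mul, norm_mul, Complex.norm_real, Real.norm_of_nonneg (Real.exp_pos _).le]
  calc rexp (-u) * ‖(u : ℂ) * (1 + b * u)‖ * ‖deriv (legendreSol l) (shiftedProd (2 * a)⁻¹ b u)‖
      ≤ rexp (-u) * (E * rexp (4⁻¹ * u)) * (D * rexp (4⁻¹ * u)) := by
        gcongr
        exact (hD u hu).2
    _ = D * E * (rexp (-u) * rexp (4⁻¹ * u) * rexp (4⁻¹ * u)) := by ring
    _ = _ := by
      rw [← Real.exp_add, ← Real.exp_add]
      ring_nf

theorem differentiableOn_legendreLaplace_inv (l : ℂ) {b : ℝ} (hb : 0 ≤ b) :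
    DifferentiableOn ℂ (fun a => legendreLaplace l (2 * a)⁻¹ b) Complex.slitPlane :=
  (locDominated_legendreKernel_inv l hb).differentiableOn Complex.isOpen_slitPlane

/-- The differential equation of `a ↦ legendreLaplace l (2 a)⁻¹ b`. -/
theorem legendreLaplace_ode (l : ℂ) {b : ℝ} (hb : 0 ≤ b) {a : ℂ} (ha : a ∈ Complex.slitPlane) :
    a ^ 2 * (deriv (deriv fun a => legendreLaplace l (2 * a)⁻¹ b) a -
      2 * deriv (fun a => legendreLaplace l (2 * a)⁻¹ b) a) =
        l * legendreLaplace l (2 * a)⁻¹ b := by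
  have h0 := locDominated_legendreKernel_inv l hb
  have h1 := h0.deriv Complex.isOpen_slitPlane
  have h2 := h1.deriv Complex.isOpen_slitPlane
  have e1 := h0.deriv_eqOn Complex.isOpen_slitPlane
  have e2 : deriv (deriv fun a => legendreLaplace l (2 * a)⁻¹ b) a =
      ∫ u in Ioi (0 : ℝ), deriv (deriv fun a => legendreKernel l (2 * a)⁻¹ b u) a := by
    refine (HasDerivAt.congr_of_eventuallyEq (h1.hasDerivAt Complex.isOpen_slitPlane ha) ?_).deriv
    filter_upwards [Complex.isOpen_slitPlane.mem_nhds ha] with w hw using e1 hw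
  have e1' : deriv (fun a => legendreLaplace l (2 * a)⁻¹ b) a =
      ∫ u in Ioi (0 : ℝ), deriv (fun a => legendreKernel l (2 * a)⁻¹ b u) a := e1 ha
  have i0 := h0.integrable ha
  have i1 := h1.integrable ha
  have i2 := h2.integrable ha
  have hint := ((i2.sub (i1.const_mul 2)).const_mul (a ^ 2)).sub (i0.const_mul l)
  -- The boundary term vanishes at `u = 0` because of its factor `u`, and at infinity by the growth
  -- bound.
  have hfin := integral_Ioi_of_hasDerivAt_of_tendsto'
    (fun u hu => hasDerivAt_legendreKernel_boundary l hb hu ha) hint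
    (tendsto_legendreKernel_boundary l hb ha)
  have hsplit : ∫ u in Ioi (0 : ℝ), (a ^ 2 * (deriv (deriv fun a : ℂ =>
      legendreKernel l (2 * a)⁻¹ b u) a - 2 * deriv (fun a : ℂ => legendreKernel l (2 * a)⁻¹ b u) a) -
          l * legendreKernel l (2 * a)⁻¹ b u) = a ^ 2 * ((∫ u in Ioi (0 : ℝ),
      deriv (deriv fun a => legendreKernel l (2 * a)⁻¹ b u) a) -
      2 * ∫ u in Ioi (0 : ℝ), deriv (fun a => legendreKernel l (2 * a)⁻¹ b u) a) -
      l * ∫ u in Ioi (0 : ℝ), legendreKernel l (2 * a)⁻¹ b u := by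
    rw [← integral_const_mul 2, ← integral_sub i2 (i1.const_mul 2), ← integral_const_mul,
      ← integral_const_mul l]
    exact integral_sub ((i2.sub (i1.const_mul 2)).const_mul (a ^ 2)) (i0.const_mul l)
  rw [hsplit] at hfin
  rw [e2, e1', legendreLaplace, ← sub_eq_zero, hfin]
  simp

/-! ### The limit along the positive half-line -/

theorem exists_norm_legendreKernel_ofReal_le (l : ℂ) (C : ℝ) :
    ∃ D : ℝ, ∀ g b : ℝ, 0 ≤ g → g ≤ C → 0 ≤ b → b ≤ C → ∀ u : ℝ, 0 ≤ u →
      ‖legendreKernel l g b u‖ ≤ D * rexp (-(3 / 4) * u) := by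
  obtain ⟨D, -, hD⟩ := exists_norm_legendreSol_shiftedProd_le l
    -- For nonnegative slopes the direction `s = 1` and sector constant `1` work, uniformly down to
    -- slope `0`.
    (c := 1 ^ 3 / (1 ^ 2 + 2)) (by norm_num) C
  refine ⟨D, fun g b hg hg' hb hb' u hu => norm_legendreKernel_le (hD g b ?_ ?_ u hu ?_).1⟩
  · rwa [Complex.norm_real, Real.norm_of_nonneg hg]
  · rwa [Complex.norm_real, Real.norm_of_nonneg hb]
  · refine shiftedProd_mem_raySector one_pos one_ne_zero (by simp) ?_ ?_ hu
    · simp [abs_of_nonneg hg]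
    · simp [abs_of_nonneg hb]

theorem shiftedProd_ofReal_mem_cutPlane {g b u : ℝ} (hg : 0 ≤ g) (hb : 0 ≤ b) (hu : 0 ≤ u) :
    shiftedProd g b u ∈ cutPlane :=
  raySector_subset (c := 1 ^ 3 / (1 ^ 2 + 2)) (by norm_num)
    (shiftedProd_mem_raySector one_pos one_ne_zero (by simp) (by simp [abs_of_nonneg hg])
      (by simp [abs_of_nonneg hb]) hu)

theorem tendsto_legendreLaplace_inv (l : ℂ) {b : ℝ} (hb : 0 ≤ b) :
    Tendsto (fun r : ℝ => legendreLaplace l (2 * (r : ℂ))⁻¹ b) atTop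
      (𝓝 (legendreLaplace l 0 b)) := by
  obtain ⟨D, hD⟩ := exists_norm_legendreKernel_ofReal_le l (max 1 b)
  have hc : ∀ r : ℝ, ((2 * (r : ℂ))⁻¹ : ℂ) = (((2 * r)⁻¹ : ℝ) : ℂ) := fun r => by push_cast; rfl
  refine tendsto_integral_filter_of_dominated_convergence _ ?_ ?_ (integrableOn_const_mul_exp D) ?_
  · filter_upwards [eventually_gt_atTop 0] with r hr
    rw [hc]
    exact (continuousOn_legendreKernel fun u hu => shiftedProd_ofReal_mem_cutPlane
      (by positivity) hb (le_of_lt hu)).aestronglyMeasurable measurableSet_Ioi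
  · filter_upwards [eventually_ge_atTop 1] with r hr
    filter_upwards [ae_restrict_mem measurableSet_Ioi] with u hu
    rw [hc]
    refine hD _ b (by positivity) (le_trans ?_ (le_max_left _ _)) hb (le_max_right _ _) u
      (le_of_lt hu)
    exact inv_le_one_of_one_le₀ (by linarith)
  · filter_upwards [ae_restrict_mem measurableSet_Ioi] with u hu
    have ht : Tendsto (fun r : ℝ => (2 * (r : ℂ))⁻¹) atTop (𝓝 0) := by
      simp only [hc]
      have : Tendsto (fun r : ℝ => (2 * r)⁻¹) atTop (𝓝 0) :=
        tendsto_inv_atTop_zero.comp (tendsto_id.const_mul_atTop (by norm_num))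
      have h2 := (Complex.continuous_ofReal.tendsto 0).comp this
      simpa [Function.comp_def] using h2
    have hm : shiftedProd 0 b u ∈ cutPlane := by
      have := shiftedProd_ofReal_mem_cutPlane (g := 0) le_rfl hb (le_of_lt hu)
      simpa using this
    have hcont : ContinuousAt (fun γ : ℂ => shiftedProd γ b u) 0 := by
      unfold shiftedProd
      fun_prop
    have hp := ((differentiableOn_legendreSol l).differentiableAt
      (isOpen_cutPlane.mem_nhds hm)).continuousAt
    exact ((hp.tendsto.comp (hcont.tendsto.comp ht)).const_mul _)

theorem legendreLaplace_zero_zero (l : ℂ) : legendreLaplace l 0 0 = 1 := by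
  have : ∀ u : ℝ, legendreKernel l 0 0 u = ((rexp (-u) : ℝ) : ℂ) := by
    intro u
    simp [legendreKernel, shiftedProd, legendreSol_zero]
  simp only [legendreLaplace, this]
  rw [integral_complex_ofReal, integral_exp_neg_Ioi_zero, Complex.ofReal_one]

/-! ### Identification with `K_ν` -/

/-- `W` solves the equation `a² (W'' - 2 W') = l W` on the cut plane, with derivatives `W₁` and
`W₂`. -/
def SolvesReduced (l : ℂ) (W W₁ W₂ : ℂ → ℂ) : Prop :=
  ∀ a ∈ Complex.slitPlane, HasDerivAt W (W₁ a) a ∧ HasDerivAt W₁ (W₂ a) a ∧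
    a ^ 2 * (W₂ a - 2 * W₁ a) = l * W a

theorem solvesReduced_legendreLaplace (l : ℂ) {b : ℝ} (hb : 0 ≤ b) :
    SolvesReduced l (fun a => legendreLaplace l (2 * a)⁻¹ b)
      (deriv fun a => legendreLaplace l (2 * a)⁻¹ b)
      (deriv (deriv fun a => legendreLaplace l (2 * a)⁻¹ b)) := by
  intro a ha
  have hn := Complex.isOpen_slitPlane.mem_nhds ha
  have hd := differentiableOn_legendreLaplace_inv l hb
  exact ⟨(hd.differentiableAt hn).hasDerivAt,
    ((hd.deriv Complex.isOpen_slitPlane).differentiableAt hn).hasDerivAt, legendreLaplace_ode l hb ha⟩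

theorem SolvesReduced.add_const_mul {l κ : ℂ} {W W₁ W₂ V V₁ V₂ : ℂ → ℂ}
    (hW : SolvesReduced l W W₁ W₂) (hV : SolvesReduced l V V₁ V₂) :
    SolvesReduced l (fun a => W a + κ * V a) (fun a => W₁ a + κ * V₁ a)
      (fun a => W₂ a + κ * V₂ a) := by
  intro a ha
  obtain ⟨h1, h2, h3⟩ := hW a ha
  obtain ⟨g1, g2, g3⟩ := hV a ha
  exact ⟨h1.add (g1.const_mul κ), h2.add (g2.const_mul κ), by linear_combination h3 + κ * g3⟩

/-- The leading term `√(π / (2 z)) e^{-z}` of the modified Bessel function. -/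
noncomputable def besselLeading (z : ℂ) : ℂ :=
  (√(π / 2) : ℂ) * (z ^ ((-(1 / 2) : ℝ) : ℂ) * Complex.exp (-z))

theorem besselLeading_ne_zero {z : ℂ} (hz : z ≠ 0) : besselLeading z ≠ 0 := by
  have h1 : (√(π / 2) : ℂ) ≠ 0 := by
    have : 0 < √(π / 2) := by positivity
    exact_mod_cast this.ne'
  have h2 : z ^ ((-(1 / 2) : ℝ) : ℂ) ≠ 0 := by
    rw [Ne, Complex.cpow_eq_zero_iff]
    simp [hz]
  exact mul_ne_zero h1 (mul_ne_zero h2 (Complex.exp_ne_zero _))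

theorem besselLeading_ofReal {r : ℝ} (hr : 0 < r) :
    besselLeading r = ((√(π / (2 * r)) * rexp (-r) : ℝ) : ℂ) := by
  have e : √(π / (2 * r)) = √(π / 2) * r ^ (-(1 / 2) : ℝ) := by
    rw [← div_div, Real.sqrt_div (by positivity), Real.rpow_neg hr.le, ← Real.sqrt_eq_rpow]
    rfl
  rw [besselLeading, ← Complex.ofReal_cpow hr.le, e]
  push_cast
  ring

theorem norm_besselLeading_sq {z : ℂ} (hz : z ≠ 0) :
    ‖besselLeading z‖ ^ 2 = π / (2 * ‖z‖) * rexp (-(2 * z.re)) := by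
  have hn : 0 < ‖z‖ := norm_pos_iff.2 hz
  rw [besselLeading, norm_mul, norm_mul, Complex.norm_real, Complex.norm_cpow_real,
    Complex.norm_exp, Real.norm_of_nonneg (by positivity), mul_pow, mul_pow,
    Real.sq_sqrt (by positivity), ← Real.rpow_natCast (‖z‖ ^ _), ← Real.rpow_mul hn.le,
    ← Real.exp_nat_mul]
  have : (-(1 / 2) * ((2 : ℕ) : ℝ) : ℝ) = -1 := by norm_num
  rw [this, Real.rpow_neg_one, Complex.neg_re]
  push_cast
  rw [mul_neg]
  field_simp

theorem hasDerivAt_besselLeading {z : ℂ} (hz : z ∈ Complex.slitPlane) :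
    HasDerivAt besselLeading (besselLeading z * (-(1 / (2 * z)) - 1)) z := by
  have h0 := Complex.slitPlane_ne_zero hz
  have h := (((hasDerivAt_id z).cpow_const (c := ((-(1 / 2) : ℝ) : ℂ)) hz).mul
    (hasDerivAt_id z).neg.cexp).const_mul (√(π / 2) : ℂ)
  refine h.congr_deriv ?_
  simp only [id, besselLeading, Pi.neg_apply]
  rw [Complex.cpow_sub _ _ h0, Complex.cpow_one]
  generalize z ^ ((-(1 / 2) : ℝ) : ℂ) = E
  generalize Complex.exp (-z) = F
  push_cast
  field_simp
  ring

/-- Removing the leading factor `z^{-1/2} e^{-z}` from the modified Bessel equation leaves exactly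
the reduced equation with `l = ν² - 1/4`, and the limit `1` is the normalization. -/
theorem SolvesReduced.isBesselK {ν : ℂ} {W W₁ W₂ : ℂ → ℂ}
    (h : SolvesReduced (ν ^ 2 - 1 / 4) W W₁ W₂)
    (hlim : Tendsto (fun r : ℝ => W r) atTop (𝓝 1)) :
    IsBesselK ν (fun z => besselLeading z * W z) := by
  have hd : ∀ z ∈ Complex.slitPlane, HasDerivAt (fun z => besselLeading z * W z)
      (besselLeading z * (W₁ z + (-(1 / (2 * z)) - 1) * W z)) z := by
    intro z hz
    refine ((hasDerivAt_besselLeading hz).mul (h z hz).1).congr_deriv ?_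
    ring
  refine ⟨fun z hz => (hd z hz).differentiableAt.differentiableWithinAt, fun z hz => ?_, ?_⟩
  · have h0 := Complex.slitPlane_ne_zero hz
    obtain ⟨h1, h2, h3⟩ := h z hz
    have hr : HasDerivAt (fun z : ℂ => -(1 / (2 * z)) - 1) (1 / (2 * z ^ 2)) z := by
      refine ((((hasDerivAt_const z (1 : ℂ)).div ((hasDerivAt_id z).const_mul 2)
        (by simpa using h0)).neg).sub_const 1).congr_deriv ?_
      simp only [id]
      field_simp
      ring
    have hdd := (((hasDerivAt_besselLeading hz).mul (h2.add (hr.mul h1))).congr_of_eventuallyEq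
      (f₁ := deriv fun z => besselLeading z * W z) (by
        filter_upwards [Complex.isOpen_slitPlane.mem_nhds hz] with w hw
        exact (hd w hw).deriv)).deriv
    rw [hdd, (hd z hz).deriv]
    simp only [Pi.add_apply, Pi.mul_apply]
    generalize besselLeading z = E
    field_simp
    linear_combination 4 * E * h3
  · refine isEquivalent_iff_exists_eq_mul.2 ⟨fun r => W r, hlim, ?_⟩
    filter_upwards [eventually_gt_atTop 0] with r hr
    rw [besselLeading_ofReal hr, Pi.mul_apply, mul_comm]

theorem isBesselK_legendreLaplace (ν : ℂ) :
    IsBesselK ν (fun z => besselLeading z * legendreLaplace (ν ^ 2 - 1 / 4) (2 * z)⁻¹ 0) := by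
  have h := solvesReduced_legendreLaplace (ν ^ 2 - 1 / 4) (le_refl (0 : ℝ))
  have hlim := tendsto_legendreLaplace_inv (ν ^ 2 - 1 / 4) (le_refl (0 : ℝ))
  simp only [Complex.ofReal_zero] at h hlim
  rw [legendreLaplace_zero_zero] at hlim
  exact h.isBesselK hlim

/-! ### The product formula -/

/-- As functions of `a`, both `L(1/(2a), b)` and `L(1/(2a), 0)` solve the reduced equation, with
limits `c = L(0, b)` and `1`. Adding `1 - c` times the second to the first gives limit `1` for every
`c`, so uniqueness of `K_ν` applies without knowing `c ≠ 0`. -/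
theorem legendreLaplace_mul_ofReal (ν : ℂ) {γ : ℂ} (hγ : γ ∈ Complex.slitPlane) {b : ℝ}
    (hb : 0 ≤ b) : legendreLaplace (ν ^ 2 - 1 / 4) γ b =
      legendreLaplace (ν ^ 2 - 1 / 4) γ 0 * legendreLaplace (ν ^ 2 - 1 / 4) b 0 := by
  set l := ν ^ 2 - 1 / 4 with hl
  set c := legendreLaplace l 0 b with hc
  have h₀ := solvesReduced_legendreLaplace l (le_refl (0 : ℝ))
  have hlim₀ := tendsto_legendreLaplace_inv l (le_refl (0 : ℝ))
  simp only [Complex.ofReal_zero] at h₀ hlim₀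
  rw [legendreLaplace_zero_zero] at hlim₀
  have h₁ := (solvesReduced_legendreLaplace l hb).add_const_mul (κ := 1 - c) h₀
  have hlim₁ := (tendsto_legendreLaplace_inv l hb).add (hlim₀.const_mul (1 - c))
  rw [← hc, mul_one, add_sub_cancel] at hlim₁
  have hmem := inv_two_mul_mem_slitPlane hγ
  have heq := (SolvesReduced.isBesselK h₁ hlim₁).eqOn (isBesselK_legendreLaplace ν) hmem
  have hne : γ ≠ 0 := Complex.slitPlane_ne_zero hγ
  have e : (2 * (2 * γ)⁻¹)⁻¹ = γ := by field_simp
  simp only [e] at heq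
  have heq' := mul_left_cancel₀ (besselLeading_ne_zero (Complex.slitPlane_ne_zero hmem)) heq
  rw [legendreLaplace_comm l b 0, ← hc]
  rw [← hl] at heq'
  linear_combination heq'

/-- Both sides are holomorphic in `β` on the half-plane `Re (β * bisector γ) > 0`, which contains
the positive reals, where the formula is known. -/
theorem legendreLaplace_mul (ν : ℂ) {γ β : ℂ} (hγ : γ ∈ Complex.slitPlane)
    (hβ : 0 < (β * bisector γ).re) : legendreLaplace (ν ^ 2 - 1 / 4) γ β =
      legendreLaplace (ν ^ 2 - 1 / 4) γ 0 * legendreLaplace (ν ^ 2 - 1 / 4) β 0 := by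
  set l := ν ^ 2 - 1 / 4 with hl
  set U : Set ℂ := {β | 0 < (β * bisector γ).re} with hU
  have hUo : IsOpen U := isOpen_lt continuous_const (by fun_prop)
  have hUc : Convex ℝ U := by
    intro z hz w hw a b ha hb hab
    have hz' : 0 < (z * bisector γ).re := hz
    have hw' : 0 < (w * bisector γ).re := hw
    have e : ((a • z + b • w) * bisector γ).re =
        a * (z * bisector γ).re + b * (w * bisector γ).re := by
      rw [add_mul, Complex.add_re, Complex.real_smul, Complex.real_smul, mul_assoc, mul_assoc,
        Complex.re_ofReal_mul, Complex.re_ofReal_mul]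
    change 0 < ((a • z + b • w) * bisector γ).re
    rw [e]
    rcases ha.eq_or_lt with rfl | ha
    · have : b = 1 := by linarith
      rwa [this, zero_mul, zero_add, one_mul]
    · exact add_pos_of_pos_of_nonneg (mul_pos ha hz') (mul_nonneg hb hw'.le)
  have hUs : U ⊆ Complex.slitPlane := by
    intro z hz
    by_contra h
    rw [Complex.mem_slitPlane_iff, not_or, not_lt, not_not] at h
    have hz' : 0 < (z * bisector γ).re := hz
    rw [Complex.mul_re, h.2, zero_mul, sub_zero] at hz'
    nlinarith [bisector_re_pos hγ, h.1]
  have hf : DifferentiableOn ℂ (fun β => legendreLaplace l γ β) U := by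
    simp only [legendreLaplace_comm l γ]
    exact (locDominated_legendreKernel l fun β hβ =>
      compatibleSlopes_of_re_pos hγ hβ).differentiableOn hUo
  have hg : DifferentiableOn ℂ (fun β => legendreLaplace l γ 0 * legendreLaplace l β 0) U := by
    refine DifferentiableOn.const_mul ?_ _
    refine (locDominated_legendreKernel l fun β hβ => ?_).differentiableOn hUo
    have := compatibleSlopes_ofReal (hUs hβ) (le_refl (0 : ℝ))
    simpa using this
  have h1 : (1 : ℂ) ∈ U := by simpa [hU] using bisector_re_pos hγ
  refine (hf.analyticOnNhd hUo).eqOn_of_preconnected_of_frequently_eq (hg.analyticOnNhd hUo)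
    hUc.isPreconnected h1 ?_ hβ
  -- Real points `r > 1` accumulate at `1`, which suffices for the identity theorem.
  have ht : Tendsto (fun r : ℝ => (r : ℂ)) (𝓝[>] 1) (𝓝[≠] 1) := by
    refine tendsto_nhdsWithin_iff.2 ⟨?_, ?_⟩
    · exact (Complex.continuous_ofReal.tendsto' 1 1 (by simp)).mono_left nhdsWithin_le_nhds
    · filter_upwards [self_mem_nhdsWithin] with r hr
      simp only [mem_compl_iff, mem_singleton_iff]
      exact_mod_cast (ne_of_gt hr)
  refine ht.frequently (Eventually.frequently ?_)
  filter_upwards [self_mem_nhdsWithin] with r hr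
  have hr' : 1 < r := hr
  exact legendreLaplace_mul_ofReal ν hγ (by linarith)

theorem legendreLaplace_conj (l : ℝ) (γ β : ℂ) :
    legendreLaplace l (starRingEnd ℂ γ) (starRingEnd ℂ β) =
      starRingEnd ℂ (legendreLaplace l γ β) := by
  rw [legendreLaplace, legendreLaplace, ← integral_conj]
  congr 1
  funext u
  have : shiftedProd (starRingEnd ℂ γ) (starRingEnd ℂ β) u = starRingEnd ℂ (shiftedProd γ β u) := by
    simp [shiftedProd]
  rw [legendreKernel, this, legendreSol_conj, legendreKernel, map_mul, Complex.conj_ofReal]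

/-- This places the conjugate of `γ` in the half-plane of the product formula, even when `Re γ < 0`.
-/
theorem conj_mul_bisector_re_pos {γ : ℂ} (h : γ ∈ Complex.slitPlane) :
    0 < (starRingEnd ℂ γ * bisector γ).re := by
  rw [conj_mul_bisector, Complex.re_ofReal_mul, Complex.conj_re]
  exact mul_pos (norm_pos_iff.2 (Complex.slitPlane_ne_zero h)) (bisector_re_pos h)

theorem norm_legendreLaplace_sq (ν : ℝ) {γ : ℂ} (hγ : γ ∈ Complex.slitPlane) :
    ((‖legendreLaplace ((ν : ℂ) ^ 2 - 1 / 4) γ 0‖ ^ 2 : ℝ) : ℂ) =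
      legendreLaplace ((ν : ℂ) ^ 2 - 1 / 4) γ (starRingEnd ℂ γ) := by
  rw [legendreLaplace_mul _ hγ (conj_mul_bisector_re_pos hγ)]
  have h := legendreLaplace_conj (ν ^ 2 - 1 / 4) γ 0
  rw [map_zero] at h
  push_cast at h ⊢
  rw [h, Complex.mul_conj, Complex.normSq_eq_norm_sq]
  push_cast
  rfl

/-! ### Return to the variables of the theorem -/

theorem two_mul_add_ne_zero {x : ℂ} (hx : x ∈ Complex.slitPlane) {u : ℝ} (hu : 0 ≤ u) :
    2 * x + (u : ℂ) ≠ 0 := by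
  intro h
  have h1 := congrArg Complex.re h
  have h2 := congrArg Complex.im h
  simp at h1 h2
  rw [Complex.mem_slitPlane_iff] at hx
  rcases hx with h3 | h3
  · linarith
  · exact h3 h2

theorem norm_two_mul_add_sq (x : ℂ) (u : ℝ) :
    ‖2 * x + (u : ℂ)‖ ^ 2 = 4 * ‖x‖ ^ 2 + u * (4 * x.re + u) := by
  rw [← Complex.normSq_eq_norm_sq, ← Complex.normSq_eq_norm_sq, Complex.normSq_apply,
    Complex.normSq_apply]
  simp
  ring

theorem shiftedProd_conj_eq {x : ℂ} (hx : x ≠ 0) {t : ℝ} (ht : 0 < t) (u : ℝ) :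
    shiftedProd (2 * ((t : ℂ) * x))⁻¹ (starRingEnd ℂ (2 * ((t : ℂ) * x))⁻¹) (t * u) =
      ((u * (4 * x.re + u) / (4 * ‖x‖ ^ 2) : ℝ) : ℂ) := by
  have ht0 : (t : ℂ) ≠ 0 := by exact_mod_cast ht.ne'
  have hn : ‖x‖ ≠ 0 := norm_ne_zero_iff.2 hx
  have e1 : (1 : ℂ) + (2 * ((t : ℂ) * x))⁻¹ * ((t * u : ℝ) : ℂ) = (2 * x + u) / (2 * x) := by
    push_cast
    field_simp
  have e2 : (1 : ℂ) + starRingEnd ℂ (2 * ((t : ℂ) * x))⁻¹ * ((t * u : ℝ) : ℂ) =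
      starRingEnd ℂ ((2 * x + u) / (2 * x)) := by
    rw [← e1]
    simp
  rw [shiftedProd, e1, e2, Complex.mul_conj, Complex.normSq_eq_norm_sq, norm_div, div_pow,
    norm_two_mul_add_sq, norm_mul, mul_pow]
  norm_cast
  push_cast
  field_simp
  ring

/-- Here `1 - Z = (2‖x‖ / ‖2x + u‖)²`, so the prefactor `(1 - Z)^{-(ν + 1/2)}` cancels the power of
`‖2x + u‖`, and `Z / (1 - Z)` is the value of the curve with conjugate slopes at `t u`. -/
theorem integrand_eq {x : ℂ} (hx : x ∈ Complex.slitPlane) {t : ℝ} (ht : 0 < t) (ν : ℝ) {u : ℝ}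
    (hu : 0 ≤ u) :
    ((rexp (-(t * u)) * ‖2 * x + (u : ℂ)‖ ^ (-2 * ν - 1) : ℝ) : ℂ) *
        hyp2F1 ((ν : ℂ) + 1 / 2) ((ν : ℂ) + 1 / 2) 1
          ((u * (4 * x.re + u) / ‖2 * x + (u : ℂ)‖ ^ 2 : ℝ) : ℂ) =
      (((2 * ‖x‖) ^ (-2 * ν - 1) : ℝ) : ℂ) * legendreKernel ((ν : ℂ) ^ 2 - 1 / 4)
        (2 * ((t : ℂ) * x))⁻¹ (starRingEnd ℂ (2 * ((t : ℂ) * x))⁻¹) (t * u) := by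
  have hx0 := Complex.slitPlane_ne_zero hx
  have hxn : 0 < ‖x‖ := norm_pos_iff.2 hx0
  have hn : 0 < ‖2 * x + (u : ℂ)‖ := norm_pos_iff.2 (two_mul_add_ne_zero hx hu)
  have hsq := norm_two_mul_add_sq x u
  rw [legendreKernel, shiftedProd_conj_eq hx0 ht]
  set n := ‖2 * x + (u : ℂ)‖ with hndef
  set Z : ℝ := u * (4 * x.re + u) / n ^ 2 with hZ
  have hZ1 : 1 - Z = (2 * ‖x‖ / n) ^ 2 := by
    rw [hZ]
    field_simp
    linarith
  have hZ1c : (1 : ℂ) - (Z : ℂ) = ((1 - Z : ℝ) : ℂ) := by push_cast; rfl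
  have hpos : 0 < 1 - Z := by
    rw [hZ1]
    positivity
  have hmem : (Z : ℂ) ∈ rightCutPlane := by
    change (1 : ℂ) - (Z : ℂ) ∈ Complex.slitPlane
    rw [hZ1c]
    exact Complex.ofReal_mem_slitPlane.2 hpos
  have harg : (Z : ℂ) / (1 - (Z : ℂ)) = ((u * (4 * x.re + u) / (4 * ‖x‖ ^ 2) : ℝ) : ℂ) := by
    rw [hZ1c, ← Complex.ofReal_div, hZ1, hZ]
    congr 1
    field_simp
    ring
  have hl : ((ν : ℂ) + 1 / 2) * ((ν : ℂ) + 1 / 2 - 1) = (ν : ℂ) ^ 2 - 1 / 4 := by ring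
  have hpow : ((1 : ℂ) - (Z : ℂ)) ^ (-((ν : ℂ) + 1 / 2)) =
      (((2 * ‖x‖) ^ (-2 * ν - 1) / n ^ (-2 * ν - 1) : ℝ) : ℂ) := by
    have : (-((ν : ℂ) + 1 / 2)) = ((-(ν + 1 / 2) : ℝ) : ℂ) := by push_cast; rfl
    rw [this, hZ1c, ← Complex.ofReal_cpow hpos.le, hZ1, ← Real.rpow_natCast (2 * ‖x‖ / n) 2,
      ← Real.rpow_mul (by positivity), ← Real.div_rpow (by positivity) hn.le]
    congr 2
    push_cast
    ring
  rw [hyp2F1_eq_legendreHyp _ hmem, legendreHyp, harg, hl, hpow]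
  have hn2 : ((n ^ (-2 * ν - 1) : ℝ) : ℂ) ≠ 0 := by
    have : 0 < n ^ (-2 * ν - 1) := by positivity
    exact_mod_cast this.ne'
  rw [Complex.ofReal_mul, Complex.ofReal_div]
  generalize ((n ^ (-2 * ν - 1) : ℝ) : ℂ) = M at *
  field_simp

theorem corollary3p4 (x : ℂ) (hx0 : x ≠ 0) (hx : |x.arg| < π) (t : ℝ) (ht : 0 < t) (ν : ℝ) :
    IntegrableOn (fun u : ℝ =>
      ((rexp (-(t * u)) * ‖2 * x + (u : ℂ)‖ ^ (-2 * ν - 1) : ℝ) : ℂ) *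
        hyp2F1 ((ν : ℂ) + 1 / 2) ((ν : ℂ) + 1 / 2) 1
          ((u * (4 * x.re + u) / ‖2 * x + (u : ℂ)‖ ^ 2 : ℝ) : ℂ)) (Ioi (0 : ℝ)) volume ∧
    ((rexp (2 * t * x.re) * ‖besselK (ν : ℂ) ((t : ℂ) * x)‖ ^ 2 : ℝ) : ℂ) =
      ((π * (2 * ‖x‖) ^ (2 * ν) : ℝ) : ℂ) *
        ∫ u in Ioi (0 : ℝ),
          ((rexp (-(t * u)) * ‖2 * x + (u : ℂ)‖ ^ (-2 * ν - 1) : ℝ) : ℂ) *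
            hyp2F1 ((ν : ℂ) + 1 / 2) ((ν : ℂ) + 1 / 2) 1
              ((u * (4 * x.re + u) / ‖2 * x + (u : ℂ)‖ ^ 2 : ℝ) : ℂ) := by
  have hxs : x ∈ Complex.slitPlane := by
    rw [Complex.mem_slitPlane_iff_arg]
    refine ⟨fun h => ?_, hx0⟩
    rw [h, abs_of_pos Real.pi_pos] at hx
    exact lt_irrefl _ hx
  have htx : (t : ℂ) * x ∈ Complex.slitPlane := by
    rw [Complex.mem_slitPlane_iff] at hxs ⊢
    simpa [ht, ht.ne'] using hxs
  have hxn : 0 < ‖x‖ := norm_pos_iff.2 hx0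
  have hγ := inv_two_mul_mem_slitPlane htx
  set γ : ℂ := (2 * ((t : ℂ) * x))⁻¹ with hγdef
  set l : ℂ := (ν : ℂ) ^ 2 - 1 / 4 with hl
  have hcong : EqOn (fun u : ℝ =>
      ((rexp (-(t * u)) * ‖2 * x + (u : ℂ)‖ ^ (-2 * ν - 1) : ℝ) : ℂ) *
        hyp2F1 ((ν : ℂ) + 1 / 2) ((ν : ℂ) + 1 / 2) 1
          ((u * (4 * x.re + u) / ‖2 * x + (u : ℂ)‖ ^ 2 : ℝ) : ℂ))
      (fun u : ℝ => (((2 * ‖x‖) ^ (-2 * ν - 1) : ℝ) : ℂ) *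
        legendreKernel l γ (starRingEnd ℂ γ) (t * u)) (Ioi 0) :=
    fun u hu => integrand_eq hxs ht ν (le_of_lt hu)
  constructor
  · refine IntegrableOn.congr_fun ?_ hcong.symm measurableSet_Ioi
    refine Integrable.const_mul ?_ _
    -- After rescaling, absolute convergence is that of the Laplace integral with slopes `γ` and its
    -- conjugate.
    refine (integrableOn_Ioi_comp_mul_left_iff (legendreKernel l γ (starRingEnd ℂ γ)) 0 ht).2 ?_
    rw [mul_zero]
    have hU : IsOpen {β : ℂ | 0 < (β * bisector γ).re} := isOpen_lt continuous_const (by fun_prop)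
    have h := (locDominated_legendreKernel l (U := {β | 0 < (β * bisector γ).re}) (β := γ)
      fun β hβ => compatibleSlopes_of_re_pos hγ hβ).integrable (conj_mul_bisector_re_pos hγ)
    refine h.congr (Eventually.of_forall fun u => ?_)
    simp only [legendreKernel, shiftedProd_comm γ]
  · rw [setIntegral_congr_fun measurableSet_Ioi hcong, integral_const_mul,
      integral_comp_mul_left_Ioi (legendreKernel l γ (starRingEnd ℂ γ)) 0 ht, mul_zero]
    change _ = _ * (_ * (t⁻¹ • legendreLaplace l γ (starRingEnd ℂ γ)))
    rw [hl, ← norm_legendreLaplace_sq ν hγ, ← hl, besselK_eq (isBesselK_legendreLaplace ν) htx,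
      norm_mul, mul_pow, norm_besselLeading_sq (Complex.slitPlane_ne_zero htx), ← hγdef,
      Complex.re_ofReal_mul, norm_mul, Complex.norm_real, Real.norm_of_nonneg ht.le,
      Complex.real_smul, ← Complex.ofReal_mul, ← Complex.ofReal_mul, ← Complex.ofReal_mul]
    congr 1
    -- Only elementary factors remain: the `t⁻¹` of the substitution and `(2‖x‖)⁻¹` match `π / (2 t
    -- ‖x‖)` from the squared leading term.
    rw [Real.exp_neg, ← mul_assoc 2 t x.re]
    have hp : (2 * ‖x‖) ^ (-2 * ν - 1) = ((2 * ‖x‖) ^ (2 * ν))⁻¹ * (2 * ‖x‖)⁻¹ := by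
      rw [show -2 * ν - 1 = -(2 * ν) + -1 by ring, Real.rpow_add (by positivity),
        Real.rpow_neg (by positivity), Real.rpow_neg_one]
    rw [hp]
    have h1 : (2 * ‖x‖) ^ (2 * ν) ≠ 0 := by positivity
    have h2 : rexp (2 * t * x.re) ≠ 0 := (Real.exp_pos _).ne'
    rw [← hl]
    generalize (2 * ‖x‖) ^ (2 * ν) = P at *
    generalize rexp (2 * t * x.re) = Q at *
    generalize ‖legendreLaplace l γ 0‖ = V
    field_simp
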